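/- **Setting.** Let $k_1,k_2$ be fixed. For each sample size $N$ let $y=X_1\beta_1+X_2\beta_2+\epsilon\in\mathbb R^N$ with random $X=[X_1\ X_2]$, $X_1$ of size $N\times k_1$, $X_2$ of size $N\times k_2$, and random errors $\epsilon$. Assume: 1. $\beta_1$ is fixed and $\beta_2=\delta/\sqrt N$ with $\delta\in\mathbb R^{k_2}$ fixed; 2. $X^\top X/N\to Q$ in probability, $Q=\begin{bmatrix}Q_{11}&Q_{12}\\Q_{21}&Q_{22}\end{bmatrix}$ positive definite; 3. $X^\top\epsilon/\sqrt N\to R\sim N(0,\Omega)$ in distribution, with $\Omega=\begin{bmatrix}\Omega_{11}&\Omega_{12}\\\Omega_{21}&\Omega_{22}\end{bmatrix}$ positive semidefinite; 4. $\hat\Omega$ is a consistent estimator of $\Omega$, that is, $\hat\Omega\to\Omega$ in probability; 5. $\mu:\mathbb R^{k_1}\to\mathbb R$ is continuously differentiable, with vector of partial derivatives $D_b$ at $b$; write $D=D_{\beta_1}$. **Estimators.** Let $M_1=I-X_1(X_1^\top X_1)^{-1}X_1^\top$. For a positive definite $S$ put $\Lambda(S)=\mathrm{diag}(S_{11},\dots,S_{k_2k_2})^{-1/2}$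 and $C(S)=\Lambda(S)\,(\Lambda(S)S\Lambda(S))^{-1/2}$. Let $\hat Q_{11}=X_1^\top X_1/N$, $\hat C=C(X_2^\top M_1X_2/N)$, $\hat\Xi=(X_1^\top X_1)^{-1}X_1^\top X_2$ and $\hat\beta_2=\hat C^\top X_2^\top M_1y/N$. For $w\in[0,1]^{k_2}$ the weighted-average least squares (WALS) estimator is $$\hat\beta_1(w)=(X_1^\top X_1)^{-1}X_1^\top y-\hat\Xi\hat C\,\mathrm{diag}(w)\,\hat\beta_2 .$$ Let $\hat\beta_1=\hat\beta_1(1,\dots,1)$ and $\hat\delta=\sqrt N\,\hat C\hat\beta_2$. The limits of $\hat C$ and $\hat\Xi$ are $C=C(Q_{22}-Q_{21}Q_{11}^{-1}Q_{12})$ and $\Xi=Q_{11}^{-1}Q_{12}$. Let $B=[-C^\top\Xi^\top\ \ C^\top]$, $V=\mathrm{diag}(C^\top\Xi^\top D)$, $H=[I\ \ 0]^\top$. **Criterion.** For a $k_2\times k_2$ matrix $\Delta$ in the place of $\delta\delta^\top$, put $$A(w;\Delta)=D^\top\Xi\Delta\Xi^\top D+w^\top VC^{-1}\Delta (C^{-1})^\top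 Vw-2w^\top VC^{-1}\Delta\Xi^\top D+D^\top Q_{11}^{-1}\Omega_{11}Q_{11}^{-1}D+w^\top VB\Omega B^\top Vw-2w^\top VB\Omega HQ_{11}^{-1}D .$$ The plug-in estimate $\widehat{\mathrm{AMSE}}(w)$ of the asymptotic mean squared error is $A(w;\Delta)$ with $Q_{11},\Xi,C,\Omega,D$ replaced by $\hat Q_{11},\hat\Xi,\hat C,\hat\Omega,D_{\hat\beta_1}$ (also inside $B$ and $V$) and with $\Delta=\hat\delta\hat\delta^\top-\hat C\hat B\hat\Omega\hat B^\top\hat C^\top$. The limiting random criterion $\mathrm{AMSE}^*(w)$ is $A(w;\Delta)$ with $\Delta=R_\delta R_\delta^\top-CB\Omega B^\top C^\top$, where $R_\delta=\delta+CBR$. **Limits.** For a diagonal matrix $W$ let $\Psi(W)=[\,Q_{11}^{-1}+\Xi CWC^\top\Xi^\top\ \ \ -\Xi CWC^\top\,]$, $$R_{\beta_1}(W)=\Xi C(I-W)C^{-1}\delta+\Psi(W)R,\qquad R_\mu(W)=D^\top R_{\beta_1}(W).$$ **Theorem.** Let $\hat w$ be a (measurable) minimizer of $\widehat{\mathrm{AMSE}}$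 over $[0,1]^{k_2}$ (almost surely on the event that $X^\top X$ is invertible), and suppose that $\mathrm{AMSE}^*$ almost surely has a unique minimizer $\tilde w^*$ over $[0,1]^{k_2}$. Then, as $N\to\infty$, $$\hat w\xrightarrow{d}\tilde w^*,\qquad \sqrt N\bigl(\hat\beta_1(\hat w)-\beta_1\bigr)\xrightarrow{d}R_{\beta_1}(\mathrm{diag}(\tilde w^*)),\qquad \sqrt N\bigl(\mu(\hat\beta_1(\hat w))-\mu(\beta_1)\bigr)\xrightarrow{d}R_\mu(\mathrm{diag}(\tilde w^*)),$$ where $\tilde w^*$, $R_{\beta_1}$ and $R_\mu$ are functions of the same $R$. The same holds (with $\hat w$ and $\tilde w^*$ defined accordingly) if in $A$ the factor $(C^{-1})^\top$ is replaced by $C$, the term $D^\top Q_{11}^{-1}\Omega_{11}Q_{11}^{-1}D$ by $D^\top Q_{11}^{-1}D$, and the sign of the last term by $+$. -/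

import Mathlib

open MeasureTheory ProbabilityTheory Filter Topology Matrix
open scoped MatrixOrder

namespace FocusedWALS

/-! ### Matrices built from second moments -/

section Moments

/-- `Λ(S) = diag(diag S)^{-1/2}`. -/
noncomputable def scaleMat {k₂ : ℕ} (S : Matrix (Fin k₂) (Fin k₂) ℝ) :
    Matrix (Fin k₂) (Fin k₂) ℝ :=
  Matrix.diagonal fun j => (√(S j j))⁻¹

/-- `P(S) = Λ(S) S Λ(S)`. -/
noncomputable def scaledMat {k₂ : ℕ} (S : Matrix (Fin k₂) (Fin k₂) ℝ) :
    Matrix (Fin k₂) (Fin k₂) ℝ :=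
  scaleMat S * S * scaleMat S

/-- `C(S) = Λ(S) P(S)^{-1/2}`, with the positive semidefinite square root. -/
noncomputable def orthoMat {k₂ : ℕ} (S : Matrix (Fin k₂) (Fin k₂) ℝ) :
    Matrix (Fin k₂) (Fin k₂) ℝ :=
  scaleMat S * (CFC.sqrt (scaledMat S))⁻¹

/-- `Q₂₂ - Q₂₁ Q₁₁⁻¹ Q₁₂`. -/
noncomputable def schurMat {k₁ k₂ : ℕ} (Q : Matrix (Fin k₁ ⊕ Fin k₂) (Fin k₁ ⊕ Fin k₂) ℝ) :
    Matrix (Fin k₂) (Fin k₂) ℝ :=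
  Q.toBlocks₂₂ - Q.toBlocks₂₁ * Q.toBlocks₁₁⁻¹ * Q.toBlocks₁₂

/-- `Ξ = Q₁₁⁻¹ Q₁₂`. -/
noncomputable def popXi {k₁ k₂ : ℕ} (Q : Matrix (Fin k₁ ⊕ Fin k₂) (Fin k₁ ⊕ Fin k₂) ℝ) :
    Matrix (Fin k₁) (Fin k₂) ℝ :=
  Q.toBlocks₁₁⁻¹ * Q.toBlocks₁₂

/-- `C = Λ P^{-1/2}`. -/
noncomputable def popC {k₁ k₂ : ℕ} (Q : Matrix (Fin k₁ ⊕ Fin k₂) (Fin k₁ ⊕ Fin k₂) ℝ) :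
    Matrix (Fin k₂) (Fin k₂) ℝ :=
  orthoMat (schurMat Q)

/-- `B = [-CᵀΞᵀ  Cᵀ]`. -/
def matB {k₁ k₂ : ℕ} (Ξ : Matrix (Fin k₁) (Fin k₂) ℝ) (C : Matrix (Fin k₂) (Fin k₂) ℝ) :
    Matrix (Fin k₂) (Fin k₁ ⊕ Fin k₂) ℝ :=
  Matrix.fromCols (-(Cᵀ * Ξᵀ)) Cᵀ

/-- `H = [I  0]ᵀ`. -/
def matH (k₁ k₂ : ℕ) : Matrix (Fin k₁ ⊕ Fin k₂) (Fin k₁) ℝ :=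
  Matrix.fromRows 1 0

/-- `V = diag(CᵀΞᵀD)`. -/
def matV {k₁ k₂ : ℕ} (Ξ : Matrix (Fin k₁) (Fin k₂) ℝ) (C : Matrix (Fin k₂) (Fin k₂) ℝ)
    (D : Fin k₁ → ℝ) : Matrix (Fin k₂) (Fin k₂) ℝ :=
  Matrix.diagonal ((Cᵀ * Ξᵀ) *ᵥ D)

end Moments

/-! ### Least squares and weighted-average least squares -/

section Sample

variable {N k₁ k₂ : ℕ}

/-- `y = X₁ β₁ + X₂ β₂ + ε` with `β₂ = δ / √N`. -/
noncomputable def response (X : Matrix (Fin N) (Fin k₁ ⊕ Fin k₂) ℝ) (ε : Fin N → ℝ)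
    (β₁ : Fin k₁ → ℝ) (δ : Fin k₂ → ℝ) : Fin N → ℝ :=
  X.toCols₁ *ᵥ β₁ + X.toCols₂ *ᵥ ((√(N : ℝ))⁻¹ • δ) + ε

/-- `X₁ᵀX₁ / N`. -/
noncomputable def hatQ₁₁ (X : Matrix (Fin N) (Fin k₁ ⊕ Fin k₂) ℝ) : Matrix (Fin k₁) (Fin k₁) ℝ :=
  (N : ℝ)⁻¹ • (X.toCols₁ᵀ * X.toCols₁)

/-- `M₁ = I - X₁ (X₁ᵀX₁)⁻¹ X₁ᵀ`. -/
noncomputable def annihilator (X : Matrix (Fin N) (Fin k₁ ⊕ Fin k₂) ℝ) :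
    Matrix (Fin N) (Fin N) ℝ :=
  1 - X.toCols₁ * (X.toCols₁ᵀ * X.toCols₁)⁻¹ * X.toCols₁ᵀ

/-- `Ξ̂ = (X₁ᵀX₁)⁻¹ X₁ᵀX₂`. -/
noncomputable def hatXi (X : Matrix (Fin N) (Fin k₁ ⊕ Fin k₂) ℝ) : Matrix (Fin k₁) (Fin k₂) ℝ :=
  (X.toCols₁ᵀ * X.toCols₁)⁻¹ * X.toCols₁ᵀ * X.toCols₂

/-- `Ĉ = Λ̂ P̂^{-1/2}`, formed from `X₂ᵀ M₁ X₂ / N`. -/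
noncomputable def hatC (X : Matrix (Fin N) (Fin k₁ ⊕ Fin k₂) ℝ) : Matrix (Fin k₂) (Fin k₂) ℝ :=
  orthoMat ((N : ℝ)⁻¹ • (X.toCols₂ᵀ * annihilator X * X.toCols₂))

/-- `X₂* = X₂ Λ̂ P̂^{-1/2}`, the semi-orthogonalized auxiliary regressors. -/
noncomputable def starX₂ (X : Matrix (Fin N) (Fin k₁ ⊕ Fin k₂) ℝ) : Matrix (Fin N) (Fin k₂) ℝ :=
  X.toCols₂ * hatC X

/-- `β̂₁,narrow = (X₁ᵀX₁)⁻¹ X₁ᵀ y`. -/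
noncomputable def narrowEst (X : Matrix (Fin N) (Fin k₁ ⊕ Fin k₂) ℝ) (y : Fin N → ℝ) :
    Fin k₁ → ℝ :=
  ((X.toCols₁ᵀ * X.toCols₁)⁻¹ * X.toCols₁ᵀ) *ᵥ y

/-- `β̂₂ = X₂*ᵀ M₁ y / N`. -/
noncomputable def auxEst (X : Matrix (Fin N) (Fin k₁ ⊕ Fin k₂) ℝ) (y : Fin N → ℝ) :
    Fin k₂ → ℝ :=
  (N : ℝ)⁻¹ • (((starX₂ X)ᵀ * annihilator X) *ᵥ y)

/-- The weighted-average least squares estimator of `β₁` with weights `w`: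
`β̂₁,narrow - Ξ̂ Λ̂ P̂^{-1/2} diag(w) β̂₂`. -/
noncomputable def walsEst (X : Matrix (Fin N) (Fin k₁ ⊕ Fin k₂) ℝ) (y : Fin N → ℝ)
    (w : Fin k₂ → ℝ) : Fin k₁ → ℝ :=
  narrowEst X y - (hatXi X * hatC X * Matrix.diagonal w) *ᵥ auxEst X y

/-- The full-model estimator of `β₁`: all weights are one. -/
noncomputable def fullEst (X : Matrix (Fin N) (Fin k₁ ⊕ Fin k₂) ℝ) (y : Fin N → ℝ) :
    Fin k₁ → ℝ :=
  walsEst X y 1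

/-- `δ̂ = √N Ĉ β̂₂`. -/
noncomputable def hatDelta (X : Matrix (Fin N) (Fin k₁ ⊕ Fin k₂) ℝ) (y : Fin N → ℝ) :
    Fin k₂ → ℝ :=
  √(N : ℝ) • (hatC X *ᵥ auxEst X y)

end Sample

/-! ### The criterion -/

section Criterion

variable {k₁ k₂ : ℕ}

/-- The vector of partial derivatives of `μ` at `b`. -/
noncomputable def partials (μ : (Fin k₁ → ℝ) → ℝ) (b : Fin k₁ → ℝ) : Fin k₁ → ℝ :=
  fun j => fderiv ℝ μ b (Pi.single j 1)

/-- Two formulas for the asymptotic mean squared error of the focused estimator. `exact` is the sum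
of the squared mean and the variance of the limit law; `displayed` is the formula one finds
displayed in its place, with `C` for `(C⁻¹)ᵀ` in the quadratic term, the opposite sign of the
covariance term, and a different term free of `w`. -/
inductive AMSEForm where
  | exact
  | displayed

/-- The asymptotic mean squared error as a function of the weights `w`, where `Δ` stands at the
place of `δδᵀ`. -/
noncomputable def AMSEForm.amse (form : AMSEForm) (Q₁₁ : Matrix (Fin k₁) (Fin k₁) ℝ)
    (Ξ : Matrix (Fin k₁) (Fin k₂) ℝ) (C : Matrix (Fin k₂) (Fin k₂) ℝ)
    (Om : Matrix (Fin k₁ ⊕ Fin k₂) (Fin k₁ ⊕ Fin k₂) ℝ) (D : Fin k₁ → ℝ)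
    (Δ : Matrix (Fin k₂) (Fin k₂) ℝ) (w : Fin k₂ → ℝ) : ℝ :=
  let B := matB Ξ C
  let V := matV Ξ C D
  match form with
  | .exact =>
      D ⬝ᵥ (Ξ * Δ * Ξᵀ) *ᵥ D
        + w ⬝ᵥ (V * C⁻¹ * Δ * (C⁻¹)ᵀ * V) *ᵥ w
        - 2 * (w ⬝ᵥ (V * C⁻¹ * Δ * Ξᵀ) *ᵥ D)
        + D ⬝ᵥ (Q₁₁⁻¹ * Om.toBlocks₁₁ * Q₁₁⁻¹) *ᵥ D
        + w ⬝ᵥ (V * B * Om * Bᵀ * V) *ᵥ w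
        - 2 * (w ⬝ᵥ (V * B * Om * matH k₁ k₂ * Q₁₁⁻¹) *ᵥ D)
  | .displayed =>
      D ⬝ᵥ (Ξ * Δ * Ξᵀ) *ᵥ D
        + w ⬝ᵥ (V * C⁻¹ * Δ * C * V) *ᵥ w
        - 2 * (w ⬝ᵥ (V * C⁻¹ * Δ * Ξᵀ) *ᵥ D)
        + D ⬝ᵥ Q₁₁⁻¹ *ᵥ D
        + w ⬝ᵥ (V * B * Om * Bᵀ * V) *ᵥ w
        + 2 * (w ⬝ᵥ (V * B * Om * matH k₁ k₂ * Q₁₁⁻¹) *ᵥ D)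

/-- `d dᵀ - C B Ω Bᵀ Cᵀ`, the bias-corrected outer product. -/
def debiased (Ξ : Matrix (Fin k₁) (Fin k₂) ℝ) (C : Matrix (Fin k₂) (Fin k₂) ℝ)
    (Om : Matrix (Fin k₁ ⊕ Fin k₂) (Fin k₁ ⊕ Fin k₂) ℝ) (d : Fin k₂ → ℝ) :
    Matrix (Fin k₂) (Fin k₂) ℝ :=
  Matrix.vecMulVec d d - C * matB Ξ C * Om * (matB Ξ C)ᵀ * Cᵀ

/-- The plug-in estimate of the asymptotic mean squared error, from the data `X`, `y` and an
estimate `Om` of the covariance matrix. -/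
noncomputable def AMSEForm.plugIn {N : ℕ} (form : AMSEForm) (μ : (Fin k₁ → ℝ) → ℝ)
    (X : Matrix (Fin N) (Fin k₁ ⊕ Fin k₂) ℝ) (y : Fin N → ℝ)
    (Om : Matrix (Fin k₁ ⊕ Fin k₂) (Fin k₁ ⊕ Fin k₂) ℝ) (w : Fin k₂ → ℝ) : ℝ :=
  form.amse (hatQ₁₁ X) (hatXi X) (hatC X) Om (partials μ (fullEst X y))
    (debiased (hatXi X) (hatC X) Om (hatDelta X y)) w

/-- The limit `δ + C B r` of `δ̂`, at the value `r` of the limiting Gaussian vector. -/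
noncomputable def limitDelta (Q : Matrix (Fin k₁ ⊕ Fin k₂) (Fin k₁ ⊕ Fin k₂) ℝ)
    (δ : Fin k₂ → ℝ) (r : Fin k₁ ⊕ Fin k₂ → ℝ) : Fin k₂ → ℝ :=
  δ + (popC Q * matB (popXi Q) (popC Q)) *ᵥ r

/-- The limiting random criterion, at the value `r` of the limiting Gaussian vector. -/
noncomputable def AMSEForm.limit (form : AMSEForm) (μ : (Fin k₁ → ℝ) → ℝ) (β₁ : Fin k₁ → ℝ)
    (δ : Fin k₂ → ℝ) (Q Om : Matrix (Fin k₁ ⊕ Fin k₂) (Fin k₁ ⊕ Fin k₂) ℝ)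
    (r : Fin k₁ ⊕ Fin k₂ → ℝ) (w : Fin k₂ → ℝ) : ℝ :=
  form.amse Q.toBlocks₁₁ (popXi Q) (popC Q) Om (partials μ β₁)
    (debiased (popXi Q) (popC Q) Om (limitDelta Q δ r)) w

/-- The set of minimizers of `f` over the cube `[0,1]^{k₂}`. -/
def cubeArgmin (f : (Fin k₂ → ℝ) → ℝ) : Set (Fin k₂ → ℝ) :=
  {w | w ∈ Set.Icc 0 1 ∧ IsMinOn f (Set.Icc 0 1) w}

/-- `Ψ(W) = [Q₁₁⁻¹ + Ξ C W Cᵀ Ξᵀ   -Ξ C W Cᵀ]`. -/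
noncomputable def matPsi (Q : Matrix (Fin k₁ ⊕ Fin k₂) (Fin k₁ ⊕ Fin k₂) ℝ)
    (W : Matrix (Fin k₂) (Fin k₂) ℝ) : Matrix (Fin k₁) (Fin k₁ ⊕ Fin k₂) ℝ :=
  Matrix.fromCols
    (Q.toBlocks₁₁⁻¹ + popXi Q * popC Q * W * (popC Q)ᵀ * (popXi Q)ᵀ)
    (-(popXi Q * popC Q * W * (popC Q)ᵀ))

/-- `R_{β₁}(W) = Ξ C (I - W) C⁻¹ δ + Ψ(W) r`. -/
noncomputable def limitBeta (Q : Matrix (Fin k₁ ⊕ Fin k₂) (Fin k₁ ⊕ Fin k₂) ℝ)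
    (δ : Fin k₂ → ℝ) (W : Matrix (Fin k₂) (Fin k₂) ℝ) (r : Fin k₁ ⊕ Fin k₂ → ℝ) : Fin k₁ → ℝ :=
  (popXi Q * popC Q * (1 - W) * (popC Q)⁻¹) *ᵥ δ + matPsi Q W *ᵥ r

/-- `R_μ(W) = Dᵀ R_{β₁}(W)`. -/
noncomputable def limitFocus (μ : (Fin k₁ → ℝ) → ℝ) (β₁ : Fin k₁ → ℝ)
    (Q : Matrix (Fin k₁ ⊕ Fin k₂) (Fin k₁ ⊕ Fin k₂) ℝ) (δ : Fin k₂ → ℝ)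
    (W : Matrix (Fin k₂) (Fin k₂) ℝ) (r : Fin k₁ ⊕ Fin k₂ → ℝ) : ℝ :=
  partials μ β₁ ⬝ᵥ limitBeta Q δ W r

end Criterion

end FocusedWALS

/-!
For `N ≥ 1` and invertible `XᵀX` everything in the theorem is an explicit function of the score
`r = Xᵀε / √N`, the second moments `G = XᵀX / N`, the covariance estimate `O` and `t = 1/√N`. Since
`C(S)ᵀ S C(S) = 1`, the estimator `δ̂` equals `δ + C B r`, and `√N (β̂₁(w) - β₁)` equals
`R_{β₁}(diag w)`, both with the population formulas evaluated at `G` in place of `Q`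
(`hatDelta_response`, `walsEst_response`). The plug-in criterion is therefore `criterion` evaluated
at `(r, G, O, t)`, and the limiting criterion is its value at `(R, Q, Ω, 0)` (`plugIn_response`,
`limit_eq_criterion`). By Slutsky's theorem `(r, G, O, t)` converges in distribution to
`(R, Q, Ω, 0)` (`tendstoInDistribution_moments`).

All these functions are continuous at positive definite `G`; the one analytic ingredient is the
continuity of the matrix square root on positive semidefinite matrices (`tendsto_orthoMat`).
Compactness of the cube and uniqueness of the limiting minimizer then force all minimizers of the
criterion at moments near `(R, Q, Ω, 0)` to be near `w̃*` (`eventually_minimizers_subset`). Thus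
the weights, the normalized error of the estimator and the normalized error of the focus (a
difference quotient of `μ` with step `t`) form a selection of a relation whose fibres shrink to the
asserted limit, `tendsto_solutionSet_fibre`.

The passage to distributions is a continuous mapping theorem for such relations,
`tendstoInDistribution_of_tendsto_fibre`: for closed `A`, the selection lies in `A` only if the
moments lie in the closure of the set of moments whose fibre meets `A`, and in the limit this
closure is reached only if the limit point lies in `A`; the portmanteau theorem concludes. The same
description of preimages of closed sets shows that `w̃*` is almost everywhere measurable.
-/

namespace FocusedWALS

/-! ### Limits in distribution of solutions of inclusions -/

section Distribution

variable {Ω Ω' E F : Type*} [TopologicalSpace E] [TopologicalSpace F]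

/-- If the fibres of `Γ` shrink to the point `y` as their index tends to `x`, then a closed set
that is met by fibres with index arbitrarily close to `x` contains `y`. -/
theorem mem_of_mem_closure_of_tendsto_fibre {Γ : Set (E × F)} {x : E} {y : F}
    (h : Tendsto Prod.snd (comap Prod.fst (𝓝 x) ⊓ 𝓟 Γ) (𝓝 y)) {A : Set F} (hA : IsClosed A)
    (hx : x ∈ closure {e | ∃ a ∈ A, (e, a) ∈ Γ}) : y ∈ A := by
  by_contra hy
  have h1 := h (hA.isOpen_compl.mem_nhds hy)
  rw [mem_map, mem_inf_principal, mem_comap] at h1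
  obtain ⟨t, ht, hsub⟩ := h1
  obtain ⟨e, het, a, ha, hea⟩ := mem_closure_iff_nhds.1 hx t ht
  exact hsub (show (e, a) ∈ Prod.fst ⁻¹' t from het) hea ha

variable [MeasurableSpace Ω] [MeasurableSpace Ω'] {P : Measure Ω} {P' : Measure Ω'}
  [MeasurableSpace E] [BorelSpace E] [MeasurableSpace F] [BorelSpace F] [SecondCountableTopology F]

/-- A selection of a random set whose fibres shrink to that selection is measurable up to a null
set, since the preimage of a closed set `A` is almost surely the event that the parameter lies in
the closure of the set of parameters whose fibres meet `A`. -/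
theorem aemeasurable_of_tendsto_fibre {T : Ω' → E} {Y : Ω' → F} (hT : AEMeasurable T P')
    {Γ : Set (E × F)} (hΓ : ∀ᵐ s ∂P', (T s, Y s) ∈ Γ)
    (hY : ∀ᵐ s ∂P', Tendsto Prod.snd (comap Prod.fst (𝓝 (T s)) ⊓ 𝓟 Γ) (𝓝 (Y s))) :
    AEMeasurable Y P' := by
  refine NullMeasurable.aemeasurable ?_
  have hY' : Measurable (fun s : NullMeasurableSpace Ω' P' => Y s) := by
    refine measurable_of_isClosed fun A hA => ?_
    have hm : NullMeasurableSet (T ⁻¹' closure {e | ∃ a ∈ A, (e, a) ∈ Γ}) P' :=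
      hT.nullMeasurableSet_preimage isClosed_closure.measurableSet
    refine NullMeasurableSet.congr hm ?_
    filter_upwards [hΓ, hY] with s h1 h2
    refine propext ⟨fun h => mem_of_mem_closure_of_tendsto_fibre h2 hA h, fun h => ?_⟩
    exact subset_closure ⟨Y s, h, h1⟩
  exact hY'

/-- **Continuous mapping theorem for random sets.** Let `T N` converge in distribution to `T'`, and
let `Y N` be a selection of the random set `{y | (T N, y) ∈ Γ}` whenever `T N` lies in an open set
`U` that contains `T'`. If the fibres of `Γ` shrink to the point `Y'` of the fibre over `T'`, then
`Y N` converges in distribution to `Y'`. -/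
theorem tendstoInDistribution_of_tendsto_fibre [IsProbabilityMeasure P]
    [IsProbabilityMeasure P'] [HasOuterApproxClosed E] [HasOuterApproxClosed F]
    {ι : Type*} {l : Filter ι} [l.IsCountablyGenerated]
    {T : ι → Ω → E} {T' : Ω' → E}
    (hT : TendstoInDistribution T l T' (fun _ => P) P') {Y : ι → Ω → F} {Y' : Ω' → F}
    (hYm : ∀ N, AEMeasurable (Y N) P) {Γ : Set (E × F)} {U : Set E} (hU : IsOpen U)
    (hTU : ∀ᵐ s ∂P', T' s ∈ U)
    (hsel : ∀ᶠ N in l, ∀ᵐ s ∂P, T N s ∈ U → (T N s, Y N s) ∈ Γ)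
    (hΓ : ∀ᵐ s ∂P', (T' s, Y' s) ∈ Γ)
    (hY : ∀ᵐ s ∂P', Tendsto Prod.snd (comap Prod.fst (𝓝 (T' s)) ⊓ 𝓟 Γ) (𝓝 (Y' s))) :
    TendstoInDistribution Y l Y' (fun _ => P) P' := by
  have hY'm : AEMeasurable Y' P' := aemeasurable_of_tendsto_fibre hT.aemeasurable_limit hΓ hY
  refine ⟨hYm, hY'm, tendsto_of_forall_isClosed_limsup_le' fun A hA => ?_⟩
  set K : Set E := closure {e | ∃ a ∈ A, (e, a) ∈ Γ} ∪ Uᶜ with hK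
  have hKc : IsClosed K := isClosed_closure.union hU.isClosed_compl
  have h1 := ProbabilityMeasure.limsup_measure_closed_le_of_tendsto hT.tendsto hKc
  simp only [ProbabilityMeasure.coe_mk] at h1 ⊢
  rw [Measure.map_apply_of_aemeasurable hY'm hA.measurableSet]
  rw [Measure.map_apply_of_aemeasurable hT.aemeasurable_limit hKc.measurableSet] at h1
  refine le_trans (limsup_le_limsup ?_) (h1.trans (measure_mono_ae ?_))
  · filter_upwards [hsel] with N hN
    rw [Measure.map_apply_of_aemeasurable (hYm N) hA.measurableSet,
      Measure.map_apply_of_aemeasurable (hT.forall_aemeasurable N) hKc.measurableSet]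
    refine measure_mono_ae ?_
    filter_upwards [hN] with s hs hsA
    by_cases hsU : T N s ∈ U
    · exact Or.inl (subset_closure ⟨Y N s, hsA, hs hsU⟩)
    · exact Or.inr hsU
  · filter_upwards [hTU, hY] with s h2 h3 h4
    rcases h4 with h4 | h4
    · exact mem_of_mem_closure_of_tendsto_fibre h3 hA h4
    · exact absurd h2 h4

end Distribution

/-- Entrywise convergence in probability of a finite array is convergence in probability. -/
theorem tendstoInMeasure_pi {Ω ι κ : Type*} {E : κ → Type*} [Fintype κ] [MeasurableSpace Ω]
    {P : Measure Ω} [∀ k, PseudoEMetricSpace (E k)] {l : Filter ι} {f : ι → Ω → ∀ k, E k}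
    {g : Ω → ∀ k, E k}
    (h : ∀ k, TendstoInMeasure P (fun n s => f n s k) l fun s => g s k) :
    TendstoInMeasure P f l g := by
  intro ε hε
  have h1 : Tendsto (fun n => ∑ k, P {s | ε ≤ edist (f n s k) (g s k)}) l (𝓝 0) := by
    simpa using tendsto_finsetSum Finset.univ fun k _ => h k ε hε
  refine tendsto_of_tendsto_of_tendsto_of_le_of_le tendsto_const_nhds h1 (fun _ => zero_le)
    fun n => ?_
  refine (measure_mono fun s hs => ?_).trans (measure_iUnion_fintype_le _ _)
  obtain ⟨k, -, hk⟩ := (Finset.le_sup_iff hε).1 (show ε ≤ _ from hs)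
  exact Set.mem_iUnion.2 ⟨k, hk⟩

/-- Stability of a unique minimizer over a compact set: if `f i → g` continuously along `l` on `K`
and `w₀` is the only minimizer of `g`, then near the end of `l` all minimizers of `f i` are close
to `w₀`. -/
theorem eventually_minimizers_subset {ι W : Type*} [TopologicalSpace W] {K : Set W}
    (hK : IsCompact K) {l : Filter ι} {f : ι → W → ℝ} {g : W → ℝ}
    (hf : ∀ w ∈ K, Tendsto (fun p : ι × W => f p.1 p.2) (l ×ˢ 𝓝 w) (𝓝 (g w))) {w₀ : W}
    (hw₀ : {w | w ∈ K ∧ IsMinOn g K w} = {w₀}) {U : Set W} (hU : U ∈ 𝓝 w₀) :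
    ∀ᶠ i in l, ∀ w, w ∈ K → IsMinOn (f i) K w → w ∈ U := by
  have h0 : w₀ ∈ K ∧ IsMinOn g K w₀ := by
    have : w₀ ∈ ({w₀} : Set W) := rfl
    rwa [← hw₀] at this
  have hlim : Tendsto (fun i => f i w₀) l (𝓝 (g w₀)) :=
    (hf w₀ h0.1).comp (tendsto_id.prodMk tendsto_const_nhds)
  have hC : IsCompact (K \ interior U) := hK.diff isOpen_interior
  have key : {p : ι × W | f p.1 w₀ < f p.1 p.2} ∈ l ×ˢ 𝓝ˢ (K \ interior U) := by
    refine hC.mem_prod_nhdsSet_of_forall fun w hw => ?_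
    have hlt : g w₀ < g w := by
      refine lt_of_le_of_ne (h0.2 hw.1) fun heq => ?_
      have : w ∈ ({w₀} : Set W) := by
        rw [← hw₀]
        exact ⟨hw.1, fun v hv => heq ▸ h0.2 hv⟩
      rw [Set.mem_singleton_iff] at this
      subst this
      exact hw.2 (mem_interior_iff_mem_nhds.2 hU)
    exact (hlim.comp tendsto_fst).eventually_lt (hf w hw.1) hlt
  obtain ⟨t, ht, V, hV, hsub⟩ := mem_prod_iff.1 key
  filter_upwards [ht] with i hi w hwK hmin
  by_contra hwU
  have hwV : w ∈ V := subset_of_mem_nhdsSet hV ⟨hwK, fun h => hwU (interior_subset h)⟩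
  have hlt : f i w₀ < f i w := hsub (Set.mk_mem_prod hi hwV)
  exact absurd (hmin h0.1) (not_le.2 hlt)

/-! ### Continuity and measurability of the orthogonalizing factor -/

section MatrixAnalysis

variable {m n : Type*}

/-- Matrices carry the product σ-algebra of their entries. -/
instance instMeasurableSpaceMatrix : MeasurableSpace (Matrix m n ℝ) :=
  inferInstanceAs (MeasurableSpace (m → n → ℝ))

instance instBorelSpaceMatrix [Countable m] [Countable n] : BorelSpace (Matrix m n ℝ) :=
  inferInstanceAs (BorelSpace (m → n → ℝ))

instance instSecondCountableTopologyMatrix [Countable m] [Countable n] :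
    SecondCountableTopology (Matrix m n ℝ) :=
  inferInstanceAs (SecondCountableTopology (m → n → ℝ))

theorem measurable_matrix {α : Type*} [MeasurableSpace α] {A : α → Matrix m n ℝ}
    (h : ∀ i j, Measurable fun s => A s i j) : Measurable A :=
  measurable_pi_iff.2 fun i => measurable_pi_iff.2 fun j => h i j

variable [Fintype m] [Fintype n]

@[fun_prop]
theorem measurable_matrix_mul {α l : Type*} [Fintype l] [MeasurableSpace α]
    {A : α → Matrix l m ℝ} {B : α → Matrix m n ℝ} (hA : Measurable A) (hB : Measurable B) :
    Measurable fun s => A s * B s :=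
  (show Continuous fun p : Matrix l m ℝ × Matrix m n ℝ => p.1 * p.2 by fun_prop).measurable.comp
    (hA.prodMk hB)

@[fun_prop]
theorem measurable_matrix_mulVec {α : Type*} [MeasurableSpace α]
    {A : α → Matrix m n ℝ} {v : α → n → ℝ} (hA : Measurable A) (hv : Measurable v) :
    Measurable fun s => A s *ᵥ v s :=
  (show Continuous fun p : Matrix m n ℝ × (n → ℝ) => p.1 *ᵥ p.2 by fun_prop).measurable.comp
    (hA.prodMk hv)

@[fun_prop]
theorem measurable_matrix_transpose {α : Type*} [MeasurableSpace α]
    {A : α → Matrix m n ℝ} (hA : Measurable A) : Measurable fun s => (A s)ᵀ :=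
  (show Continuous fun p : Matrix m n ℝ => pᵀ by fun_prop).measurable.comp hA

@[fun_prop]
theorem measurable_matrix_diagonal {α : Type*} [DecidableEq n] [MeasurableSpace α]
    {v : α → n → ℝ} (hv : Measurable v) : Measurable fun s => Matrix.diagonal (v s) :=
  (show Continuous fun p : n → ℝ => Matrix.diagonal p by fun_prop).measurable.comp hv

@[fun_prop]
theorem measurable_matrix_smul {α : Type*} [MeasurableSpace α]
    {A : α → Matrix m n ℝ} (hA : Measurable A) (c : ℝ) : Measurable fun s => c • A s :=
  (show Continuous fun p : Matrix m n ℝ => c • p by fun_prop).measurable.comp hA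

@[fun_prop]
theorem measurable_matrix_sub {α : Type*} [MeasurableSpace α]
    {A B : α → Matrix m n ℝ} (hA : Measurable A) (hB : Measurable B) :
    Measurable fun s => A s - B s :=
  (show Continuous fun p : Matrix m n ℝ × Matrix m n ℝ => p.1 - p.2 by fun_prop).measurable.comp
    (hA.prodMk hB)

@[fun_prop]
theorem measurable_matrix_inv {α : Type*} [DecidableEq n] [MeasurableSpace α]
    {A : α → Matrix n n ℝ} (hA : Measurable A) : Measurable fun s => (A s)⁻¹ := by
  have hdet : Measurable fun s => (A s).det :=
    (show Continuous fun p : Matrix n n ℝ => p.det by fun_prop).measurable.comp hA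
  have hadj : Measurable fun s => (A s).adjugate :=
    (show Continuous fun p : Matrix n n ℝ => p.adjugate by fun_prop).measurable.comp hA
  simp only [Matrix.inv_def, Ring.inverse_eq_inv']
  exact (show Continuous fun p : ℝ × Matrix n n ℝ => p.1 • p.2 by fun_prop).measurable.comp
    (hdet.inv.prodMk hadj)

theorem tendsto_matrix_mul {α l p : Type*} {f : Filter α} {A : α → Matrix l m ℝ}
    {B : α → Matrix m p ℝ} {A₀ : Matrix l m ℝ} {B₀ : Matrix m p ℝ} (hA : Tendsto A f (𝓝 A₀))
    (hB : Tendsto B f (𝓝 B₀)) : Tendsto (fun a => A a * B a) f (𝓝 (A₀ * B₀)) :=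
  ((show Continuous fun q : Matrix l m ℝ × Matrix m p ℝ => q.1 * q.2 by fun_prop).tendsto
    (A₀, B₀)).comp (hA.prodMk_nhds hB)

theorem tendsto_matrix_inv {α : Type*} [DecidableEq n] {l : Filter α} {A : α → Matrix n n ℝ}
    {A₀ : Matrix n n ℝ} (hA : Tendsto A l (𝓝 A₀)) (h : A₀.det ≠ 0) :
    Tendsto (fun a => (A a)⁻¹) l (𝓝 A₀⁻¹) := by
  refine (continuousAt_matrix_inv A₀ ?_).tendsto.comp hA
  rw [Ring.inverse_eq_inv']
  exact continuousAt_inv₀ h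

open scoped Matrix.Norms.L2Operator in
theorem continuousOn_matrix_sqrt [DecidableEq n] :
    ContinuousOn (CFC.sqrt : Matrix n n ℝ → Matrix n n ℝ) {A | A.PosSemidef} := by
  have h := CFC.continuousOn_sqrt (A := Matrix n n ℝ)
  simp only [Matrix.nonneg_iff_posSemidef] at h
  exact h

theorem isClosed_posSemidef : IsClosed {A : Matrix n n ℝ | A.PosSemidef} := by
  simp only [Matrix.posSemidef_iff_dotProduct_mulVec, Set.ofPred_and, Set.ofPred_forall]
  refine IsClosed.inter ?_ (isClosed_iInter fun x => ?_)
  · exact isClosed_eq (by fun_prop) continuous_id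
  · exact isClosed_le continuous_const (by fun_prop)

/-- The square root is continuous on the closed set of positive semidefinite matrices, and takes
the junk value zero off it. -/
theorem measurable_matrix_sqrt [DecidableEq n] :
    Measurable (CFC.sqrt : Matrix n n ℝ → Matrix n n ℝ) := by
  classical
  have h : (CFC.sqrt : Matrix n n ℝ → Matrix n n ℝ)
      = Set.piecewise {A | A.PosSemidef} CFC.sqrt (fun _ => 0) := by
    funext A
    by_cases hA : A.PosSemidef
    · rw [Set.piecewise_eq_of_mem _ _ _ (show A ∈ {A | A.PosSemidef} from hA)]
    · rw [Set.piecewise_eq_of_notMem _ _ _ (show A ∉ {A | A.PosSemidef} from hA),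
        CFC.sqrt_of_not_nonneg (by rwa [Matrix.nonneg_iff_posSemidef])]
  rw [h]
  exact continuousOn_matrix_sqrt.measurable_piecewise continuousOn_const
    isClosed_posSemidef.measurableSet

end MatrixAnalysis

section Ortho

variable {k₁ k₂ : ℕ}

theorem posDef_scaledMat {S : Matrix (Fin k₂) (Fin k₂) ℝ} (hS : S.PosDef) :
    (scaledMat S).PosDef := by
  have hu : IsUnit (scaleMat S) := by
    rw [scaleMat, Matrix.isUnit_diagonal, Pi.isUnit_iff]
    exact fun j => (inv_ne_zero (Real.sqrt_pos.2 hS.diag_pos).ne').isUnit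
  have h := hS.conjTranspose_mul_mul_same (B := scaleMat S)
    (Matrix.mulVec_injective_of_isUnit hu)
  simpa [scaledMat, scaleMat, Matrix.diagonal_conjTranspose] using h

theorem sqrt_scaledMat_mul_self {S : Matrix (Fin k₂) (Fin k₂) ℝ} (hS : S.PosDef) :
    CFC.sqrt (scaledMat S) * CFC.sqrt (scaledMat S) = scaledMat S :=
  CFC.sqrt_mul_sqrt_self _ (Matrix.nonneg_iff_posSemidef.2 (posDef_scaledMat hS).posSemidef)

theorem det_sqrt_scaledMat_ne_zero {S : Matrix (Fin k₂) (Fin k₂) ℝ} (hS : S.PosDef) :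
    (CFC.sqrt (scaledMat S)).det ≠ 0 := fun h => by
  have h1 := congrArg Matrix.det (sqrt_scaledMat_mul_self hS)
  rw [Matrix.det_mul, h, zero_mul] at h1
  exact (posDef_scaledMat hS).det_pos.ne h1

/-- `C(S)` orthonormalizes the quadratic form `S`. -/
theorem orthoMat_transpose_mul_mul {S : Matrix (Fin k₂) (Fin k₂) ℝ} (hS : S.PosDef) :
    (orthoMat S)ᵀ * S * orthoMat S = 1 := by
  set K := CFC.sqrt (scaledMat S) with hK
  have hKt : Kᵀ = K := by
    have h : K.PosSemidef := Matrix.nonneg_iff_posSemidef.1 (CFC.sqrt_nonneg _)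
    simpa [Matrix.IsHermitian, Matrix.conjTranspose_eq_transpose_of_trivial] using h.1
  have hΛ : (scaleMat S)ᵀ = scaleMat S := by simp [scaleMat]
  have hu : IsUnit K.det := (det_sqrt_scaledMat_ne_zero hS).isUnit
  calc (orthoMat S)ᵀ * S * orthoMat S = K⁻¹ * scaledMat S * K⁻¹ := by
        rw [orthoMat, ← hK, Matrix.transpose_mul, Matrix.transpose_nonsing_inv, hKt, hΛ]
        simp only [scaledMat, Matrix.mul_assoc]
    _ = K⁻¹ * K * (K * K⁻¹) := by
        rw [← sqrt_scaledMat_mul_self hS, ← hK]; simp only [Matrix.mul_assoc]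
    _ = 1 := by rw [Matrix.nonsing_inv_mul _ hu, Matrix.mul_nonsing_inv _ hu, one_mul]

theorem inv_orthoMat {S : Matrix (Fin k₂) (Fin k₂) ℝ} (hS : S.PosDef) :
    (orthoMat S)⁻¹ = (orthoMat S)ᵀ * S :=
  Matrix.inv_eq_left_inv (orthoMat_transpose_mul_mul hS)

theorem orthoMat_mul_transpose_mul {S : Matrix (Fin k₂) (Fin k₂) ℝ} (hS : S.PosDef) :
    orthoMat S * (orthoMat S)ᵀ * S = 1 := by
  rw [Matrix.mul_assoc]
  exact mul_eq_one_comm.1 (orthoMat_transpose_mul_mul hS)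

theorem det_orthoMat_ne_zero {S : Matrix (Fin k₂) (Fin k₂) ℝ} (hS : S.PosDef) :
    (orthoMat S).det ≠ 0 := fun h => by
  have h1 := congrArg Matrix.det (orthoMat_transpose_mul_mul hS)
  rw [Matrix.det_mul, h, mul_zero, Matrix.det_one] at h1
  exact zero_ne_one h1

theorem tendsto_orthoMat {α : Type*} {l : Filter α} {S : α → Matrix (Fin k₂) (Fin k₂) ℝ}
    {S₀ : Matrix (Fin k₂) (Fin k₂) ℝ} (hS : Tendsto S l (𝓝 S₀)) (hS₀ : S₀.PosDef)
    (hpos : ∀ᶠ a in l, (S a).PosDef) : Tendsto (fun a => orthoMat (S a)) l (𝓝 (orthoMat S₀)) := by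
  have hΛ : Tendsto (fun a => scaleMat (S a)) l (𝓝 (scaleMat S₀)) := by
    refine ((continuous_id.matrix_diagonal).tendsto _).comp (tendsto_pi_nhds.2 fun j => ?_)
    have hj : Tendsto (fun a => S a j j) l (𝓝 (S₀ j j)) :=
      ((continuous_id.matrix_elem j j).tendsto _).comp hS
    exact hj.sqrt.inv₀ (Real.sqrt_pos.2 hS₀.diag_pos).ne'
  have hP : Tendsto (fun a => scaledMat (S a)) l (𝓝 (scaledMat S₀)) :=
    tendsto_matrix_mul (tendsto_matrix_mul hΛ hS) hΛ
  have hK : Tendsto (fun a => CFC.sqrt (scaledMat (S a))) l (𝓝 (CFC.sqrt (scaledMat S₀))) := by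
    refine (continuousOn_matrix_sqrt _ (posDef_scaledMat hS₀).posSemidef).tendsto.comp
      (tendsto_nhdsWithin_iff.2 ⟨hP, ?_⟩)
    filter_upwards [hpos] with a ha using (posDef_scaledMat ha).posSemidef
  exact tendsto_matrix_mul hΛ (tendsto_matrix_inv hK (det_sqrt_scaledMat_ne_zero hS₀))

@[fun_prop]
theorem measurable_orthoMat {α : Type*} [MeasurableSpace α] {S : α → Matrix (Fin k₂) (Fin k₂) ℝ}
    (hS : Measurable S) : Measurable fun s => orthoMat (S s) := by
  have hΛ : Measurable fun s => scaleMat (S s) := by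
    refine measurable_matrix_diagonal (measurable_pi_iff.2 fun j => ?_)
    exact (measurable_pi_iff.1 (measurable_pi_iff.1 hS j) j).sqrt.inv
  have hP : Measurable fun s => scaledMat (S s) := by unfold scaledMat; fun_prop
  exact measurable_matrix_mul hΛ (measurable_matrix_inv (measurable_matrix_sqrt.comp hP))

/-! ### Blocks of the second-moment matrix -/

section Blocks

variable {Q : Matrix (Fin k₁ ⊕ Fin k₂) (Fin k₁ ⊕ Fin k₂) ℝ}

theorem transpose_toBlocks₁₂ (hQ : Q.PosDef) : Q.toBlocks₁₂ᵀ = Q.toBlocks₂₁ := by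
  ext i j
  exact hQ.1.apply (Sum.inr i) (Sum.inl j)

theorem posDef_toBlocks₁₁ (hQ : Q.PosDef) : Q.toBlocks₁₁.PosDef :=
  hQ.submatrix Sum.inl_injective

theorem posDef_schurMat (hQ : Q.PosDef) : (schurMat Q).PosDef := by
  have hA := posDef_toBlocks₁₁ hQ
  let := hA.isUnit.invertible
  have hb : Q = Matrix.fromBlocks Q.toBlocks₁₁ Q.toBlocks₁₂ Q.toBlocks₁₂ᴴ Q.toBlocks₂₂ := by
    rw [Matrix.conjTranspose_eq_transpose_of_trivial, transpose_toBlocks₁₂ hQ,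
      Matrix.fromBlocks_toBlocks]
  have hs : schurMat Q = Q.toBlocks₂₂ - Q.toBlocks₁₂ᴴ * Q.toBlocks₁₁⁻¹ * Q.toBlocks₁₂ := by
    rw [Matrix.conjTranspose_eq_transpose_of_trivial, transpose_toBlocks₁₂ hQ, schurMat]
  have hpsd : (schurMat Q).PosSemidef := by
    rw [hs, ← Matrix.PosDef.fromBlocks₁₁ _ _ hA, ← hb]
    exact hQ.posSemidef
  rw [hpsd.posDef_iff_det_ne_zero]
  intro h0
  have hd := Matrix.det_fromBlocks₁₁ Q.toBlocks₁₁ Q.toBlocks₁₂ Q.toBlocks₁₂ᴴ Q.toBlocks₂₂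
  rw [← hb, Matrix.invOf_eq_nonsing_inv, ← hs, h0, mul_zero] at hd
  exact hQ.det_pos.ne' hd

theorem transpose_popXi (hQ : Q.PosDef) : (popXi Q)ᵀ = Q.toBlocks₂₁ * Q.toBlocks₁₁⁻¹ := by
  have h : Q.toBlocks₁₁ᵀ = Q.toBlocks₁₁ := by
    simpa [Matrix.IsHermitian, Matrix.conjTranspose_eq_transpose_of_trivial]
      using (posDef_toBlocks₁₁ hQ).1
  rw [popXi, Matrix.transpose_mul, Matrix.transpose_nonsing_inv, h, transpose_toBlocks₁₂ hQ]

variable {α : Type*} {l : Filter α} {G : α → Matrix (Fin k₁ ⊕ Fin k₂) (Fin k₁ ⊕ Fin k₂) ℝ}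

theorem tendsto_inv_toBlocks₁₁ (hQ : Q.PosDef) (hG : Tendsto G l (𝓝 Q)) :
    Tendsto (fun a => (G a).toBlocks₁₁⁻¹) l (𝓝 Q.toBlocks₁₁⁻¹) :=
  tendsto_matrix_inv (((continuous_id.matrix_submatrix Sum.inl Sum.inl).tendsto Q).comp hG)
    (posDef_toBlocks₁₁ hQ).det_pos.ne'

theorem tendsto_popXi (hQ : Q.PosDef) (hG : Tendsto G l (𝓝 Q)) :
    Tendsto (fun a => popXi (G a)) l (𝓝 (popXi Q)) :=
  tendsto_matrix_mul (tendsto_inv_toBlocks₁₁ hQ hG)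
    (((continuous_id.matrix_submatrix Sum.inl Sum.inr).tendsto Q).comp hG)

theorem tendsto_popC (hQ : Q.PosDef) (hG : Tendsto G l (𝓝 Q)) (hpos : ∀ᶠ a in l, (G a).PosDef) :
    Tendsto (fun a => popC (G a)) l (𝓝 (popC Q)) := by
  refine tendsto_orthoMat ?_ (posDef_schurMat hQ) (hpos.mono fun a ha => posDef_schurMat ha)
  have h {κ κ' : Type} (e : κ → Fin k₁ ⊕ Fin k₂) (e' : κ' → Fin k₁ ⊕ Fin k₂) :
      Tendsto (fun a => (G a).submatrix e e') l (𝓝 (Q.submatrix e e')) :=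
    ((continuous_id.matrix_submatrix e e').tendsto Q).comp hG
  exact (h Sum.inr Sum.inr).sub (tendsto_matrix_mul
    (tendsto_matrix_mul (h Sum.inr Sum.inl) (tendsto_inv_toBlocks₁₁ hQ hG)) (h Sum.inl Sum.inr))

end Blocks

end Ortho

/-! ### Sample quantities as functions of the moments -/

section SampleAlgebra

variable {N k₁ k₂ : ℕ}

/-- The normalized second moments `XᵀX / N`. -/
noncomputable def sampleGram (X : Matrix (Fin N) (Fin k₁ ⊕ Fin k₂) ℝ) :
    Matrix (Fin k₁ ⊕ Fin k₂) (Fin k₁ ⊕ Fin k₂) ℝ :=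
  (N : ℝ)⁻¹ • (Xᵀ * X)

/-- The normalized scores `Xᵀε / √N`. -/
noncomputable def score (X : Matrix (Fin N) (Fin k₁ ⊕ Fin k₂) ℝ) (ε : Fin N → ℝ) :
    Fin k₁ ⊕ Fin k₂ → ℝ :=
  (√(N : ℝ))⁻¹ • (Xᵀ *ᵥ ε)

/-- `Sδ + r₂ - Ξᵀr₁` with `S` the Schur complement of `Q₁₁`: the normalized residual correlation
of the auxiliary regressors with the response. -/
noncomputable def auxScore (Q : Matrix (Fin k₁ ⊕ Fin k₂) (Fin k₁ ⊕ Fin k₂) ℝ)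
    (δ : Fin k₂ → ℝ) (r : Fin k₁ ⊕ Fin k₂ → ℝ) : Fin k₂ → ℝ :=
  schurMat Q *ᵥ δ + r ∘ Sum.inr - (popXi Q)ᵀ *ᵥ (r ∘ Sum.inl)

theorem matB_mulVec (Ξ : Matrix (Fin k₁) (Fin k₂) ℝ) (C : Matrix (Fin k₂) (Fin k₂) ℝ)
    (r : Fin k₁ ⊕ Fin k₂ → ℝ) :
    matB Ξ C *ᵥ r = Cᵀ *ᵥ (r ∘ Sum.inr - Ξᵀ *ᵥ (r ∘ Sum.inl)) := by
  rw [matB, Matrix.fromCols_mulVec, Matrix.mulVec_sub, Matrix.mulVec_mulVec, Matrix.neg_mulVec]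
  abel

theorem limitDelta_eq {Q : Matrix (Fin k₁ ⊕ Fin k₂) (Fin k₁ ⊕ Fin k₂) ℝ} (hQ : Q.PosDef)
    (δ : Fin k₂ → ℝ) (r : Fin k₁ ⊕ Fin k₂ → ℝ) :
    limitDelta Q δ r = (popC Q * (popC Q)ᵀ) *ᵥ auxScore Q δ r := by
  have h : (popC Q * (popC Q)ᵀ) *ᵥ (schurMat Q *ᵥ δ) = δ := by
    rw [Matrix.mulVec_mulVec, popC, orthoMat_mul_transpose_mul (posDef_schurMat hQ),
      Matrix.one_mulVec]
  rw [limitDelta, auxScore, add_sub_assoc, Matrix.mulVec_add, h, ← Matrix.mulVec_mulVec,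
    matB_mulVec, Matrix.mulVec_mulVec]

theorem limitBeta_eq {Q : Matrix (Fin k₁ ⊕ Fin k₂) (Fin k₁ ⊕ Fin k₂) ℝ} (hQ : Q.PosDef)
    (δ : Fin k₂ → ℝ) (W : Matrix (Fin k₂) (Fin k₂) ℝ) (r : Fin k₁ ⊕ Fin k₂ → ℝ) :
    limitBeta Q δ W r = popXi Q *ᵥ δ + Q.toBlocks₁₁⁻¹ *ᵥ (r ∘ Sum.inl)
      - (popXi Q * popC Q * W * (popC Q)ᵀ) *ᵥ auxScore Q δ r := by
  have hS := posDef_schurMat hQ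
  have h1 : popC Q * (popC Q)⁻¹ = 1 :=
    Matrix.mul_nonsing_inv _ (det_orthoMat_ne_zero hS).isUnit
  have h2 : (popXi Q * popC Q * (1 - W) * (popC Q)⁻¹) *ᵥ δ
      = popXi Q *ᵥ δ - (popXi Q * popC Q * W * (popC Q)ᵀ) *ᵥ (schurMat Q *ᵥ δ) := by
    rw [Matrix.mul_sub, Matrix.sub_mul, Matrix.mul_one, Matrix.mul_assoc (popXi Q) (popC Q) _⁻¹,
      h1, Matrix.mul_one, Matrix.sub_mulVec, Matrix.mulVec_mulVec, popC, inv_orthoMat hS]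
    simp only [Matrix.mul_assoc]
  rw [limitBeta, h2, matPsi, Matrix.fromCols_mulVec, auxScore, Matrix.mulVec_sub,
    Matrix.mulVec_add, Matrix.add_mulVec, Matrix.neg_mulVec, Matrix.mulVec_mulVec (r ∘ Sum.inl)]
  abel

variable {X : Matrix (Fin N) (Fin k₁ ⊕ Fin k₂) ℝ}

theorem posDef_sampleGram (h : (sampleGram X).det ≠ 0) : (sampleGram X).PosDef := by
  have hp : (sampleGram X).PosSemidef :=
    (by simpa [Matrix.conjTranspose_eq_transpose_of_trivial]
      using Matrix.posSemidef_conjTranspose_mul_self X : (Xᵀ * X).PosSemidef).smul (by positivity)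
  exact hp.posDef_iff_det_ne_zero.2 h

theorem hatQ₁₁_eq : hatQ₁₁ X = (sampleGram X).toBlocks₁₁ := rfl

theorem inv_sampleGram₁₁ (hN : N ≠ 0) (hX : (sampleGram X).PosDef) :
    (X.toCols₁ᵀ * X.toCols₁)⁻¹ = (N : ℝ)⁻¹ • (sampleGram X).toBlocks₁₁⁻¹ := by
  have hN' : (N : ℝ) ≠ 0 := Nat.cast_ne_zero.2 hN
  have h : X.toCols₁ᵀ * X.toCols₁ = (N : ℝ) • (sampleGram X).toBlocks₁₁ := by
    rw [← hatQ₁₁_eq, hatQ₁₁, smul_smul, mul_inv_cancel₀ hN', one_smul]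
  have hu : IsUnit (sampleGram X).toBlocks₁₁.det := (posDef_toBlocks₁₁ hX).det_pos.ne'.isUnit
  refine Matrix.inv_eq_left_inv ?_
  rw [h, Matrix.smul_mul, Matrix.mul_smul, smul_smul, inv_mul_cancel₀ hN', one_smul,
    Matrix.nonsing_inv_mul _ hu]

theorem toCols₁_mul_toCols₂ (hN : N ≠ 0) :
    X.toCols₁ᵀ * X.toCols₂ = (N : ℝ) • (sampleGram X).toBlocks₁₂ := by
  have h : (sampleGram X).toBlocks₁₂ = (N : ℝ)⁻¹ • (X.toCols₁ᵀ * X.toCols₂) := rfl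
  rw [h, smul_smul, mul_inv_cancel₀ (Nat.cast_ne_zero.2 hN), one_smul]

theorem toCols₂_mul_toCols₁ (hN : N ≠ 0) :
    X.toCols₂ᵀ * X.toCols₁ = (N : ℝ) • (sampleGram X).toBlocks₂₁ := by
  have h : (sampleGram X).toBlocks₂₁ = (N : ℝ)⁻¹ • (X.toCols₂ᵀ * X.toCols₁) := rfl
  rw [h, smul_smul, mul_inv_cancel₀ (Nat.cast_ne_zero.2 hN), one_smul]

theorem hatXi_eq (hN : N ≠ 0) (hX : (sampleGram X).PosDef) : hatXi X = popXi (sampleGram X) := by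
  rw [hatXi, inv_sampleGram₁₁ hN hX, Matrix.mul_assoc, toCols₁_mul_toCols₂ hN, Matrix.smul_mul,
    Matrix.mul_smul, smul_smul, inv_mul_cancel₀ (Nat.cast_ne_zero.2 hN), one_smul, popXi]

/-- `X₂ᵀM₁ = X₂ᵀ - ΞᵀX₁ᵀ`. -/
theorem toCols₂_mul_annihilator (hN : N ≠ 0) (hX : (sampleGram X).PosDef) :
    X.toCols₂ᵀ * annihilator X = X.toCols₂ᵀ - (popXi (sampleGram X))ᵀ * X.toCols₁ᵀ := by
  rw [annihilator, Matrix.mul_sub, Matrix.mul_one, ← Matrix.mul_assoc, ← Matrix.mul_assoc,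
    toCols₂_mul_toCols₁ hN, inv_sampleGram₁₁ hN hX, Matrix.smul_mul, Matrix.mul_smul, smul_smul,
    mul_inv_cancel₀ (Nat.cast_ne_zero.2 hN), one_smul, transpose_popXi hX]

theorem toCols₂_mul_annihilator_mul_toCols₁ (hN : N ≠ 0) (hX : (sampleGram X).PosDef) :
    X.toCols₂ᵀ * annihilator X * X.toCols₁ = 0 := by
  have h : X.toCols₁ᵀ * X.toCols₁ = (N : ℝ) • (sampleGram X).toBlocks₁₁ := by
    rw [← hatQ₁₁_eq, hatQ₁₁, smul_smul, mul_inv_cancel₀ (Nat.cast_ne_zero.2 hN), one_smul]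
  rw [toCols₂_mul_annihilator hN hX, Matrix.sub_mul, Matrix.mul_assoc _ X.toCols₁ᵀ, h,
    toCols₂_mul_toCols₁ hN, transpose_popXi hX, Matrix.mul_smul, Matrix.mul_assoc,
    Matrix.nonsing_inv_mul _ (posDef_toBlocks₁₁ hX).det_pos.ne'.isUnit, Matrix.mul_one, sub_self]

theorem toCols₂_mul_annihilator_mul_toCols₂ (hN : N ≠ 0) (hX : (sampleGram X).PosDef) :
    X.toCols₂ᵀ * annihilator X * X.toCols₂ = (N : ℝ) • schurMat (sampleGram X) := by
  have h : X.toCols₂ᵀ * X.toCols₂ = (N : ℝ) • (sampleGram X).toBlocks₂₂ := by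
    have h : (sampleGram X).toBlocks₂₂ = (N : ℝ)⁻¹ • (X.toCols₂ᵀ * X.toCols₂) := rfl
    rw [h, smul_smul, mul_inv_cancel₀ (Nat.cast_ne_zero.2 hN), one_smul]
  rw [toCols₂_mul_annihilator hN hX, Matrix.sub_mul, Matrix.mul_assoc _ X.toCols₁ᵀ, h,
    toCols₁_mul_toCols₂ hN, transpose_popXi hX, Matrix.mul_smul, ← smul_sub, schurMat]

theorem hatC_eq (hN : N ≠ 0) (hX : (sampleGram X).PosDef) : hatC X = popC (sampleGram X) := by
  rw [hatC, toCols₂_mul_annihilator_mul_toCols₂ hN hX, smul_smul,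
    inv_mul_cancel₀ (Nat.cast_ne_zero.2 hN), one_smul, popC]

theorem transpose_toCols₁_mulVec (hN : N ≠ 0) (ε : Fin N → ℝ) :
    X.toCols₁ᵀ *ᵥ ε = √(N : ℝ) • (score X ε ∘ Sum.inl) := by
  have hs : √(N : ℝ) ≠ 0 := (Real.sqrt_pos.2 (by positivity)).ne'
  have h : score X ε ∘ Sum.inl = (√(N : ℝ))⁻¹ • (X.toCols₁ᵀ *ᵥ ε) := rfl
  rw [h, smul_smul, mul_inv_cancel₀ hs, one_smul]

theorem transpose_toCols₂_mulVec (hN : N ≠ 0) (ε : Fin N → ℝ) :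
    X.toCols₂ᵀ *ᵥ ε = √(N : ℝ) • (score X ε ∘ Sum.inr) := by
  have hs : √(N : ℝ) ≠ 0 := (Real.sqrt_pos.2 (by positivity)).ne'
  have h : score X ε ∘ Sum.inr = (√(N : ℝ))⁻¹ • (X.toCols₂ᵀ *ᵥ ε) := rfl
  rw [h, smul_smul, mul_inv_cancel₀ hs, one_smul]

theorem inv_natCast_mul_sqrt (N : ℕ) : (N : ℝ)⁻¹ * √(N : ℝ) = (√(N : ℝ))⁻¹ := by
  rw [mul_comm, ← div_eq_mul_inv, Real.sqrt_div_self']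
  simp

theorem narrowEst_response (hN : N ≠ 0) (hX : (sampleGram X).PosDef) (ε : Fin N → ℝ)
    (β₁ : Fin k₁ → ℝ) (δ : Fin k₂ → ℝ) :
    narrowEst X (response X ε β₁ δ) = β₁ + (√(N : ℝ))⁻¹ • (popXi (sampleGram X) *ᵥ δ
      + (sampleGram X).toBlocks₁₁⁻¹ *ᵥ (score X ε ∘ Sum.inl)) := by
  have hu : IsUnit (X.toCols₁ᵀ * X.toCols₁).det := by
    rw [show X.toCols₁ᵀ * X.toCols₁ = (N : ℝ) • (sampleGram X).toBlocks₁₁ by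
      rw [← hatQ₁₁_eq, hatQ₁₁, smul_smul, mul_inv_cancel₀ (Nat.cast_ne_zero.2 hN), one_smul],
      Matrix.det_smul]
    exact (mul_ne_zero (pow_ne_zero _ (Nat.cast_ne_zero.2 hN))
      (posDef_toBlocks₁₁ hX).det_pos.ne').isUnit
  rw [narrowEst, response, Matrix.mulVec_add, Matrix.mulVec_add, Matrix.mulVec_mulVec,
    Matrix.mulVec_mulVec, Matrix.mul_assoc _ _ X.toCols₁, Matrix.nonsing_inv_mul _ hu,
    Matrix.one_mulVec, ← hatXi, hatXi_eq hN hX, Matrix.mulVec_smul,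
    ← Matrix.mulVec_mulVec ε, transpose_toCols₁_mulVec hN, inv_sampleGram₁₁ hN hX,
    Matrix.mulVec_smul, Matrix.smul_mulVec, smul_smul, mul_comm (√(N : ℝ)),
    inv_natCast_mul_sqrt, smul_add, add_assoc]

theorem auxEst_response (hN : N ≠ 0) (hX : (sampleGram X).PosDef) (ε : Fin N → ℝ)
    (β₁ : Fin k₁ → ℝ) (δ : Fin k₂ → ℝ) :
    auxEst X (response X ε β₁ δ)
      = (√(N : ℝ))⁻¹ • ((popC (sampleGram X))ᵀ *ᵥ auxScore (sampleGram X) δ (score X ε)) := by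
  have hN' : (N : ℝ) ≠ 0 := Nat.cast_ne_zero.2 hN
  have h : (X.toCols₂ᵀ * annihilator X) *ᵥ response X ε β₁ δ
      = √(N : ℝ) • auxScore (sampleGram X) δ (score X ε) := by
    have hs : (√(N : ℝ))⁻¹ * (N : ℝ) = √(N : ℝ) := by
      rw [mul_comm, ← div_eq_mul_inv, Real.div_sqrt]
    rw [response, Matrix.mulVec_add, Matrix.mulVec_add, Matrix.mulVec_mulVec, Matrix.mulVec_smul,
      Matrix.mulVec_smul, Matrix.mulVec_mulVec, toCols₂_mul_annihilator_mul_toCols₁ hN hX,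
      toCols₂_mul_annihilator_mul_toCols₂ hN hX, Matrix.zero_mulVec, zero_add,
      toCols₂_mul_annihilator hN hX, Matrix.sub_mulVec, ← Matrix.mulVec_mulVec ε,
      transpose_toCols₁_mulVec hN, transpose_toCols₂_mulVec hN, Matrix.mulVec_smul,
      Matrix.smul_mulVec, smul_smul, hs, auxScore, smul_sub, smul_add, add_sub_assoc]
  rw [auxEst, starX₂, Matrix.transpose_mul, Matrix.mul_assoc, ← Matrix.mulVec_mulVec, h,
    Matrix.mulVec_smul, smul_smul, inv_natCast_mul_sqrt, hatC_eq hN hX]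

theorem hatDelta_response (hN : N ≠ 0) (hX : (sampleGram X).PosDef) (ε : Fin N → ℝ)
    (β₁ : Fin k₁ → ℝ) (δ : Fin k₂ → ℝ) :
    hatDelta X (response X ε β₁ δ) = limitDelta (sampleGram X) δ (score X ε) := by
  have hs : √(N : ℝ) ≠ 0 := (Real.sqrt_pos.2 (by positivity)).ne'
  rw [hatDelta, auxEst_response hN hX, hatC_eq hN hX, Matrix.mulVec_smul, smul_smul,
    mul_inv_cancel₀ hs, one_smul, Matrix.mulVec_mulVec, limitDelta_eq hX]

/-- The estimation error is exactly `1/√N` times the limit formula, evaluated at the sample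
moments. -/
theorem walsEst_response (hN : N ≠ 0) (hX : (sampleGram X).PosDef) (ε : Fin N → ℝ)
    (β₁ : Fin k₁ → ℝ) (δ : Fin k₂ → ℝ) (w : Fin k₂ → ℝ) :
    walsEst X (response X ε β₁ δ) w
      = β₁ + (√(N : ℝ))⁻¹ • limitBeta (sampleGram X) δ (Matrix.diagonal w) (score X ε) := by
  rw [walsEst, narrowEst_response hN hX, auxEst_response hN hX, limitBeta_eq hX, hatXi_eq hN hX,
    hatC_eq hN hX, Matrix.mulVec_smul, Matrix.mulVec_mulVec, smul_sub, add_sub_assoc]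

/-- The plug-in criterion as a function of the normalized score `r`, the second moments `G`, the
covariance estimate `O` and `t = 1/√N`. Its value at `(R, Q, Ω, 0)` is the limiting criterion. -/
noncomputable def criterion (form : AMSEForm) (μ : (Fin k₁ → ℝ) → ℝ) (β₁ : Fin k₁ → ℝ)
    (δ : Fin k₂ → ℝ) (r : Fin k₁ ⊕ Fin k₂ → ℝ)
    (G O : Matrix (Fin k₁ ⊕ Fin k₂) (Fin k₁ ⊕ Fin k₂) ℝ) (t : ℝ) (w : Fin k₂ → ℝ) : ℝ :=
  form.amse G.toBlocks₁₁ (popXi G) (popC G) O (partials μ (β₁ + t • limitBeta G δ 1 r))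
    (debiased (popXi G) (popC G) O (limitDelta G δ r)) w

theorem plugIn_response (form : AMSEForm) (μ : (Fin k₁ → ℝ) → ℝ) (hN : N ≠ 0)
    (hX : (sampleGram X).PosDef) (ε : Fin N → ℝ) (β₁ : Fin k₁ → ℝ) (δ : Fin k₂ → ℝ)
    (O : Matrix (Fin k₁ ⊕ Fin k₂) (Fin k₁ ⊕ Fin k₂) ℝ) :
    form.plugIn μ X (response X ε β₁ δ) O
      = criterion form μ β₁ δ (score X ε) (sampleGram X) O (√(N : ℝ))⁻¹ := by
  funext w
  rw [AMSEForm.plugIn, criterion, fullEst, walsEst_response hN hX, hatDelta_response hN hX,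
    hatXi_eq hN hX, hatC_eq hN hX, hatQ₁₁_eq]
  rw [show Matrix.diagonal (1 : Fin k₂ → ℝ) = 1 from Matrix.diagonal_one]

theorem limit_eq_criterion (form : AMSEForm) (μ : (Fin k₁ → ℝ) → ℝ) (β₁ : Fin k₁ → ℝ)
    (δ : Fin k₂ → ℝ) (Q O : Matrix (Fin k₁ ⊕ Fin k₂) (Fin k₁ ⊕ Fin k₂) ℝ)
    (r : Fin k₁ ⊕ Fin k₂ → ℝ) :
    form.limit μ β₁ δ Q O r = criterion form μ β₁ δ r Q O 0 := by
  funext w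
  rw [AMSEForm.limit, criterion, zero_smul, add_zero]

end SampleAlgebra

/-! ### Continuity of the criterion and of the limit formulas -/

section Continuity

variable {k₁ k₂ : ℕ}

theorem tendsto_matrix_transpose {α m n : Type*} {l : Filter α} {A : α → Matrix m n ℝ}
    {A₀ : Matrix m n ℝ} (hA : Tendsto A l (𝓝 A₀)) : Tendsto (fun a => (A a)ᵀ) l (𝓝 A₀ᵀ) :=
  (continuous_id.matrix_transpose.tendsto A₀).comp hA

theorem tendsto_mulVec {α m n : Type*} [Fintype n] {l : Filter α} {A : α → Matrix m n ℝ}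
    {A₀ : Matrix m n ℝ} {v : α → n → ℝ} {v₀ : n → ℝ} (hA : Tendsto A l (𝓝 A₀))
    (hv : Tendsto v l (𝓝 v₀)) : Tendsto (fun a => A a *ᵥ v a) l (𝓝 (A₀ *ᵥ v₀)) :=
  ((show Continuous fun p : Matrix m n ℝ × (n → ℝ) => p.1 *ᵥ p.2 by fun_prop).tendsto
    (A₀, v₀)).comp (hA.prodMk_nhds hv)

theorem tendsto_dotProduct {α n : Type*} [Fintype n] {l : Filter α} {u v : α → n → ℝ}
    {u₀ v₀ : n → ℝ} (hu : Tendsto u l (𝓝 u₀)) (hv : Tendsto v l (𝓝 v₀)) :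
    Tendsto (fun a => u a ⬝ᵥ v a) l (𝓝 (u₀ ⬝ᵥ v₀)) :=
  ((show Continuous fun p : (n → ℝ) × (n → ℝ) => p.1 ⬝ᵥ p.2 by fun_prop).tendsto
    (u₀, v₀)).comp (hu.prodMk_nhds hv)

theorem tendsto_fromCols {α m n₁ n₂ : Type*} {l : Filter α} {A : α → Matrix m n₁ ℝ}
    {B : α → Matrix m n₂ ℝ} {A₀ : Matrix m n₁ ℝ} {B₀ : Matrix m n₂ ℝ}
    (hA : Tendsto A l (𝓝 A₀)) (hB : Tendsto B l (𝓝 B₀)) :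
    Tendsto (fun a => Matrix.fromCols (A a) (B a)) l (𝓝 (Matrix.fromCols A₀ B₀)) := by
  refine tendsto_pi_nhds.2 fun i => tendsto_pi_nhds.2 fun j => ?_
  cases j with
  | inl j => exact ((continuous_id.matrix_elem i j).tendsto A₀).comp hA
  | inr j => exact ((continuous_id.matrix_elem i j).tendsto B₀).comp hB

theorem tendsto_matB {α : Type*} {l : Filter α} {Ξ : α → Matrix (Fin k₁) (Fin k₂) ℝ}
    {Ξ' : Matrix (Fin k₁) (Fin k₂) ℝ} {C : α → Matrix (Fin k₂) (Fin k₂) ℝ}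
    {C' : Matrix (Fin k₂) (Fin k₂) ℝ} (hΞ : Tendsto Ξ l (𝓝 Ξ')) (hC : Tendsto C l (𝓝 C')) :
    Tendsto (fun a => matB (Ξ a) (C a)) l (𝓝 (matB Ξ' C')) :=
  tendsto_fromCols
    (tendsto_matrix_mul (tendsto_matrix_transpose hC) (tendsto_matrix_transpose hΞ)).neg
    (tendsto_matrix_transpose hC)

theorem tendsto_amse (form : AMSEForm) {α : Type*} {l : Filter α}
    {Q₁₁ : α → Matrix (Fin k₁) (Fin k₁) ℝ} {Q₁₁' : Matrix (Fin k₁) (Fin k₁) ℝ}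
    {Ξ : α → Matrix (Fin k₁) (Fin k₂) ℝ} {Ξ' : Matrix (Fin k₁) (Fin k₂) ℝ}
    {C : α → Matrix (Fin k₂) (Fin k₂) ℝ} {C' : Matrix (Fin k₂) (Fin k₂) ℝ}
    {O : α → Matrix (Fin k₁ ⊕ Fin k₂) (Fin k₁ ⊕ Fin k₂) ℝ}
    {O' : Matrix (Fin k₁ ⊕ Fin k₂) (Fin k₁ ⊕ Fin k₂) ℝ}
    {D : α → Fin k₁ → ℝ} {D' : Fin k₁ → ℝ} {Δ : α → Matrix (Fin k₂) (Fin k₂) ℝ}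
    {Δ' : Matrix (Fin k₂) (Fin k₂) ℝ} {w : α → Fin k₂ → ℝ} {w' : Fin k₂ → ℝ}
    (hQ : Tendsto (fun a => (Q₁₁ a)⁻¹) l (𝓝 Q₁₁'⁻¹)) (hΞ : Tendsto Ξ l (𝓝 Ξ'))
    (hC : Tendsto C l (𝓝 C')) (hCi : Tendsto (fun a => (C a)⁻¹) l (𝓝 C'⁻¹))
    (hO : Tendsto O l (𝓝 O')) (hD : Tendsto D l (𝓝 D')) (hΔ : Tendsto Δ l (𝓝 Δ'))
    (hw : Tendsto w l (𝓝 w')) :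
    Tendsto (fun a => form.amse (Q₁₁ a) (Ξ a) (C a) (O a) (D a) (Δ a) (w a)) l
      (𝓝 (form.amse Q₁₁' Ξ' C' O' D' Δ' w')) := by
  have hΞt := tendsto_matrix_transpose hΞ
  have hB := tendsto_matB hΞ hC
  have hBt := tendsto_matrix_transpose hB
  have hV : Tendsto (fun a => matV (Ξ a) (C a) (D a)) l (𝓝 (matV Ξ' C' D')) :=
    (continuous_id.matrix_diagonal.tendsto _).comp
      (tendsto_mulVec (tendsto_matrix_mul (tendsto_matrix_transpose hC) hΞt) hD)
  have hO₁₁ : Tendsto (fun a => (O a).toBlocks₁₁) l (𝓝 O'.toBlocks₁₁) :=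
    ((continuous_id.matrix_submatrix Sum.inl Sum.inl).tendsto O').comp hO
  have hVΔ := tendsto_matrix_mul (tendsto_matrix_mul hV hCi) hΔ
  have hVBO := tendsto_matrix_mul (tendsto_matrix_mul hV hB) hO
  have h1 := tendsto_dotProduct hD
    (tendsto_mulVec (tendsto_matrix_mul (tendsto_matrix_mul hΞ hΔ) hΞt) hD)
  have h3 := (tendsto_dotProduct hw (tendsto_mulVec (tendsto_matrix_mul hVΔ hΞt) hD)).const_mul 2
  have h5 := tendsto_dotProduct hw
    (tendsto_mulVec (tendsto_matrix_mul (tendsto_matrix_mul hVBO hBt) hV) hw)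
  have h6 := (tendsto_dotProduct hw (tendsto_mulVec (tendsto_matrix_mul
    (tendsto_matrix_mul hVBO (tendsto_const_nhds (x := matH k₁ k₂))) hQ) hD)).const_mul 2
  cases form with
  | exact =>
    have h2 := tendsto_dotProduct hw (tendsto_mulVec (tendsto_matrix_mul
      (tendsto_matrix_mul hVΔ (tendsto_matrix_transpose hCi)) hV) hw)
    have h4 := tendsto_dotProduct hD
      (tendsto_mulVec (tendsto_matrix_mul (tendsto_matrix_mul hQ hO₁₁) hQ) hD)
    exact ((((h1.add h2).sub h3).add h4).add h5).sub h6
  | displayed =>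
    have h2 := tendsto_dotProduct hw (tendsto_mulVec (tendsto_matrix_mul
      (tendsto_matrix_mul hVΔ hC) hV) hw)
    have h4 := tendsto_dotProduct hD (tendsto_mulVec hQ hD)
    exact ((((h1.add h2).sub h3).add h4).add h5).add h6

theorem continuous_partials {μ : (Fin k₁ → ℝ) → ℝ} (hμ : ContDiff ℝ 1 μ) :
    Continuous (partials μ) :=
  continuous_pi fun _ => (hμ.continuous_fderiv one_ne_zero).clm_apply continuous_const

variable {α : Type*} {l : Filter α} {G : α → Matrix (Fin k₁ ⊕ Fin k₂) (Fin k₁ ⊕ Fin k₂) ℝ}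
  {Q : Matrix (Fin k₁ ⊕ Fin k₂) (Fin k₁ ⊕ Fin k₂) ℝ}
  {r : α → Fin k₁ ⊕ Fin k₂ → ℝ} {r₀ : Fin k₁ ⊕ Fin k₂ → ℝ}

theorem tendsto_inv_popC (hQ : Q.PosDef) (hG : Tendsto G l (𝓝 Q))
    (hpos : ∀ᶠ a in l, (G a).PosDef) :
    Tendsto (fun a => (popC (G a))⁻¹) l (𝓝 (popC Q)⁻¹) :=
  tendsto_matrix_inv (tendsto_popC hQ hG hpos) (det_orthoMat_ne_zero (posDef_schurMat hQ))

theorem tendsto_limitBeta (hQ : Q.PosDef) (hG : Tendsto G l (𝓝 Q))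
    (hpos : ∀ᶠ a in l, (G a).PosDef) (δ : Fin k₂ → ℝ) {W : α → Matrix (Fin k₂) (Fin k₂) ℝ}
    {W₀ : Matrix (Fin k₂) (Fin k₂) ℝ} (hW : Tendsto W l (𝓝 W₀)) (hr : Tendsto r l (𝓝 r₀)) :
    Tendsto (fun a => limitBeta (G a) δ (W a) (r a)) l (𝓝 (limitBeta Q δ W₀ r₀)) := by
  have hΞ := tendsto_popXi hQ hG
  have hC := tendsto_popC hQ hG hpos
  have hΞC := tendsto_matrix_mul hΞ hC
  have hM := tendsto_matrix_mul (tendsto_matrix_mul hΞC hW) (tendsto_matrix_transpose hC)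
  exact (tendsto_mulVec (tendsto_matrix_mul (tendsto_matrix_mul hΞC (tendsto_const_nhds.sub hW))
      (tendsto_inv_popC hQ hG hpos)) tendsto_const_nhds).add
    (tendsto_mulVec (tendsto_fromCols ((tendsto_inv_toBlocks₁₁ hQ hG).add
      (tendsto_matrix_mul hM (tendsto_matrix_transpose hΞ))) hM.neg) hr)

theorem tendsto_criterion (form : AMSEForm) {μ : (Fin k₁ → ℝ) → ℝ} (hμ : ContDiff ℝ 1 μ)
    (β₁ : Fin k₁ → ℝ) (δ : Fin k₂ → ℝ) (hQ : Q.PosDef) (hG : Tendsto G l (𝓝 Q))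
    (hpos : ∀ᶠ a in l, (G a).PosDef) (hr : Tendsto r l (𝓝 r₀))
    {O : α → Matrix (Fin k₁ ⊕ Fin k₂) (Fin k₁ ⊕ Fin k₂) ℝ}
    {O₀ : Matrix (Fin k₁ ⊕ Fin k₂) (Fin k₁ ⊕ Fin k₂) ℝ} (hO : Tendsto O l (𝓝 O₀))
    {t : α → ℝ} {t₀ : ℝ} (ht : Tendsto t l (𝓝 t₀)) {w : α → Fin k₂ → ℝ} {w₀ : Fin k₂ → ℝ}
    (hw : Tendsto w l (𝓝 w₀)) :
    Tendsto (fun a => criterion form μ β₁ δ (r a) (G a) (O a) (t a) (w a)) l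
      (𝓝 (criterion form μ β₁ δ r₀ Q O₀ t₀ w₀)) := by
  have hΞ := tendsto_popXi hQ hG
  have hC := tendsto_popC hQ hG hpos
  refine tendsto_amse form (tendsto_inv_toBlocks₁₁ hQ hG) hΞ hC (tendsto_inv_popC hQ hG hpos) hO
    ?_ ?_ hw
  · exact ((continuous_partials hμ).tendsto _).comp (tendsto_const_nhds.add
      (ht.smul (tendsto_limitBeta hQ hG hpos δ tendsto_const_nhds hr)))
  · have hB := tendsto_matB hΞ hC
    have hδ : Tendsto (fun a => limitDelta (G a) δ (r a)) l (𝓝 (limitDelta Q δ r₀)) :=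
      tendsto_const_nhds.add (tendsto_mulVec (tendsto_matrix_mul hC hB) hr)
    have hd := ((show Continuous fun d : Fin k₂ → ℝ => Matrix.vecMulVec d d by fun_prop).tendsto
      _).comp hδ
    exact hd.sub (tendsto_matrix_mul (tendsto_matrix_mul (tendsto_matrix_mul
      (tendsto_matrix_mul hC hB) hO) (tendsto_matrix_transpose hB)) (tendsto_matrix_transpose hC))

/-! ### The delta method -/

theorem fderiv_apply_eq_partials (μ : (Fin k₁ → ℝ) → ℝ) (β b : Fin k₁ → ℝ) :
    fderiv ℝ μ β b = partials μ β ⬝ᵥ b := by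
  have h := (fderiv ℝ μ β).toLinearMap.pi_apply_eq_sum_univ b
  rw [ContinuousLinearMap.coe_coe] at h
  rw [h, dotProduct]
  refine Finset.sum_congr rfl fun j _ => ?_
  have hj : (fun i => if j = i then (1 : ℝ) else 0) = Pi.single j 1 := by
    funext i
    simp [Pi.single_apply, eq_comm]
  rw [smul_eq_mul, mul_comm, partials, hj]

/-- The difference quotient `(μ(β + tb) - μ(β)) / t`, written so that its value at `t = 0` (where
`t⁻¹ = 0`) is the directional derivative. -/
noncomputable def focusQuotient (μ : (Fin k₁ → ℝ) → ℝ) (β : Fin k₁ → ℝ) (t : ℝ)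
    (b : Fin k₁ → ℝ) : ℝ :=
  partials μ β ⬝ᵥ b + t⁻¹ * (μ (β + t • b) - μ β - t * (partials μ β ⬝ᵥ b))

theorem focusQuotient_zero (μ : (Fin k₁ → ℝ) → ℝ) (β b : Fin k₁ → ℝ) :
    focusQuotient μ β 0 b = partials μ β ⬝ᵥ b := by
  simp [focusQuotient]

theorem focusQuotient_of_ne_zero (μ : (Fin k₁ → ℝ) → ℝ) (β b : Fin k₁ → ℝ) {t : ℝ} (ht : t ≠ 0) :
    focusQuotient μ β t b = t⁻¹ * (μ (β + t • b) - μ β) := by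
  rw [focusQuotient]
  field_simp
  ring

theorem tendsto_focusQuotient {μ : (Fin k₁ → ℝ) → ℝ} {β : Fin k₁ → ℝ}
    (hμ : DifferentiableAt ℝ μ β) {t : α → ℝ} (ht : Tendsto t l (𝓝 0)) {b : α → Fin k₁ → ℝ}
    {b₀ : Fin k₁ → ℝ} (hb : Tendsto b l (𝓝 b₀)) :
    Tendsto (fun a => focusQuotient μ β (t a) (b a)) l (𝓝 (focusQuotient μ β 0 b₀)) := by
  have h1 : Tendsto (fun a => partials μ β ⬝ᵥ b a) l (𝓝 (partials μ β ⬝ᵥ b₀)) :=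
    ((show Continuous fun x : Fin k₁ → ℝ => partials μ β ⬝ᵥ x by fun_prop).tendsto b₀).comp hb
  have htb : Tendsto (fun a => t a • b a) l (𝓝 0) := by simpa using ht.smul hb
  have ho := (hasFDerivAt_iff_isLittleO_nhds_zero.1 hμ.hasFDerivAt).comp_tendsto htb
  have hO : (fun a => t a • b a) =O[l] t := by
    simpa using (Asymptotics.isBigO_refl t l).smul (hb.isBigO_one ℝ)
  have h2 := (ho.trans_isBigO hO).tendsto_inv_smul_nhds_zero
  rw [focusQuotient_zero]
  simpa [focusQuotient, Function.comp_def, fderiv_apply_eq_partials] using h1.add h2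

end Continuity

/-! ### Asymptotics of the minimizing weights and of the estimator -/

section Limits

variable {k₁ k₂ : ℕ}

instance instPseudoMetrizableSpaceMatrix {m n : Type*} [Countable m] [Countable n] :
    TopologicalSpace.PseudoMetrizableSpace (Matrix m n ℝ) :=
  inferInstanceAs (TopologicalSpace.PseudoMetrizableSpace (m → n → ℝ))

/-- The values `(r, G, O, t)` of the score, the second moments, the covariance estimate and
`1/√N`. -/
abbrev MomentSpace (k₁ k₂ : ℕ) : Type :=
  (Fin k₁ ⊕ Fin k₂ → ℝ) × Matrix (Fin k₁ ⊕ Fin k₂) (Fin k₁ ⊕ Fin k₂) ℝ ×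
    Matrix (Fin k₁ ⊕ Fin k₂) (Fin k₁ ⊕ Fin k₂) ℝ × ℝ

/-- The pairs of a moment vector `(r, G, O, t)`, with `G` positive definite, and a triple of
minimizing weights, the normalized estimation error at these weights, and the normalized error of
the focus. -/
def solutionSet (form : AMSEForm) (μ : (Fin k₁ → ℝ) → ℝ) (β₁ : Fin k₁ → ℝ) (δ : Fin k₂ → ℝ) :
    Set (MomentSpace k₁ k₂ × ((Fin k₂ → ℝ) × (Fin k₁ → ℝ) × ℝ)) :=
  {p | p.1.2.1.PosDef ∧
    p.2.1 ∈ cubeArgmin (criterion form μ β₁ δ p.1.1 p.1.2.1 p.1.2.2.1 p.1.2.2.2) ∧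
    p.2.2.1 = limitBeta p.1.2.1 δ (Matrix.diagonal p.2.1) p.1.1 ∧
    p.2.2.2 = focusQuotient μ β₁ p.1.2.2.2 p.2.2.1}

/-- Where the limiting criterion has a unique minimizer, the fibres of `solutionSet` shrink to a
point. -/
theorem tendsto_solutionSet_fibre (form : AMSEForm) {μ : (Fin k₁ → ℝ) → ℝ} (hμ : ContDiff ℝ 1 μ)
    (β₁ : Fin k₁ → ℝ) (δ : Fin k₂ → ℝ) {Q O : Matrix (Fin k₁ ⊕ Fin k₂) (Fin k₁ ⊕ Fin k₂) ℝ}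
    (hQ : Q.PosDef) (r : Fin k₁ ⊕ Fin k₂ → ℝ) {w : Fin k₂ → ℝ}
    (hw : cubeArgmin (form.limit μ β₁ δ Q O r) = {w}) :
    Tendsto Prod.snd
      (comap Prod.fst (𝓝 ((r, Q, O, 0) : MomentSpace k₁ k₂)) ⊓ 𝓟 (solutionSet form μ β₁ δ))
      (𝓝 (w, limitBeta Q δ (Matrix.diagonal w) r,
        limitFocus μ β₁ Q δ (Matrix.diagonal w) r)) := by
  set L := comap Prod.fst (𝓝 ((r, Q, O, 0) : MomentSpace k₁ k₂)) ⊓ 𝓟 (solutionSet form μ β₁ δ)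
  have hfst : Tendsto Prod.fst L (𝓝 ((r, Q, O, 0) : MomentSpace k₁ k₂)) :=
    tendsto_comap.mono_left inf_le_left
  have hsol : ∀ᶠ p in L, p ∈ solutionSet form μ β₁ δ := mem_inf_of_right (mem_principal_self _)
  have hr := hfst.fst_nhds
  have hG := hfst.snd_nhds.fst_nhds
  have hO := hfst.snd_nhds.snd_nhds.fst_nhds
  have ht := hfst.snd_nhds.snd_nhds.snd_nhds
  have hpos : ∀ᶠ p in L, p.1.2.1.PosDef := hsol.mono fun p hp => hp.1
  have h1 : Tendsto (fun p => p.2.1) L (𝓝 w) := by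
    intro U hU
    have hmin := eventually_minimizers_subset (l := L)
      (f := fun p => criterion form μ β₁ δ p.1.1 p.1.2.1 p.1.2.2.1 p.1.2.2.2)
      (isCompact_Icc : IsCompact (Set.Icc (0 : Fin k₂ → ℝ) 1)) (fun v _ => ?_) hw hU
    · exact (hmin.and hsol).mono fun p hp => hp.1 _ hp.2.2.1.1 hp.2.2.1.2
    · rw [limit_eq_criterion]
      exact tendsto_criterion form hμ β₁ δ hQ (hG.comp tendsto_fst)
        (tendsto_fst.eventually hpos) (hr.comp tendsto_fst) (hO.comp tendsto_fst)
        (ht.comp tendsto_fst) tendsto_snd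
  have h2 : Tendsto (fun p => p.2.2.1) L (𝓝 (limitBeta Q δ (Matrix.diagonal w) r)) := by
    refine (tendsto_limitBeta hQ hG hpos δ
      ((continuous_id.matrix_diagonal.tendsto w).comp h1) hr).congr' ?_
    filter_upwards [hsol] with p hp using hp.2.2.1.symm
  have h3 : Tendsto (fun p => p.2.2.2) L (𝓝 (limitFocus μ β₁ Q δ (Matrix.diagonal w) r)) := by
    rw [limitFocus, ← focusQuotient_zero]
    refine (tendsto_focusQuotient (hμ.differentiable one_ne_zero β₁) ht h2).congr' ?_
    filter_upwards [hsol] with p hp using hp.2.2.2.symm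
  exact h1.prodMk_nhds (h2.prodMk_nhds h3)

/-- The sample moments converge jointly in distribution, by Slutsky's theorem. -/
theorem tendstoInDistribution_moments {S S' : Type*} [MeasurableSpace S] [MeasurableSpace S']
    {P : Measure S} [IsProbabilityMeasure P] {P' : Measure S'} [IsProbabilityMeasure P']
    {r : ℕ → S → Fin k₁ ⊕ Fin k₂ → ℝ} {R : S' → Fin k₁ ⊕ Fin k₂ → ℝ}
    {G O : ℕ → S → Matrix (Fin k₁ ⊕ Fin k₂) (Fin k₁ ⊕ Fin k₂) ℝ}
    {Q Om : Matrix (Fin k₁ ⊕ Fin k₂) (Fin k₁ ⊕ Fin k₂) ℝ}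
    (hr : TendstoInDistribution r atTop R (fun _ => P) P')
    (hGm : ∀ N, Measurable (G N)) (hOm : ∀ N, Measurable (O N))
    (hG : ∀ i j, TendstoInMeasure P (fun N s => G N s i j) atTop (fun _ => Q i j))
    (hO : ∀ i j, TendstoInMeasure P (fun N s => O N s i j) atTop (fun _ => Om i j)) :
    TendstoInDistribution (fun (N : ℕ) s => ((r N s, G N s, O N s, (√(N : ℝ))⁻¹) :
      MomentSpace k₁ k₂)) atTop (fun s => (R s, Q, Om, 0)) (fun _ => P) P' := by
  have hfun {A : ℕ → S → Matrix (Fin k₁ ⊕ Fin k₂) (Fin k₁ ⊕ Fin k₂) ℝ}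
      {B : Matrix (Fin k₁ ⊕ Fin k₂) (Fin k₁ ⊕ Fin k₂) ℝ}
      (h : ∀ i j, TendstoInMeasure P (fun N s => A N s i j) atTop (fun _ => B i j)) :
      TendstoInMeasure P (fun N s i j => A N s i j) atTop (fun _ i j => B i j) :=
    tendstoInMeasure_pi fun i => tendstoInMeasure_pi fun j => h i j
  have ht : TendstoInMeasure P (fun (N : ℕ) (_ : S) => (√(N : ℝ))⁻¹) atTop (fun _ => (0 : ℝ)) :=
    tendstoInMeasure_of_tendsto_ae (fun N => aestronglyMeasurable_const) <|
      ae_of_all _ fun _ =>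
        (Real.tendsto_sqrt_atTop.comp tendsto_natCast_atTop_atTop).inv_tendsto_atTop
  have h1 := hr.prodMk_of_tendstoInMeasure_const _ (fun N s i j => G N s i j) _ (hfun hG)
    fun N => (hGm N).aemeasurable
  have h2 := h1.prodMk_of_tendstoInMeasure_const _ (fun N s i j => O N s i j) _ (hfun hO)
    fun N => (hOm N).aemeasurable
  have h3 := h2.prodMk_of_tendstoInMeasure_const _ _ _ ht fun N => aemeasurable_const
  exact h3.continuous_comp (g := fun p => (p.1.1.1, Matrix.of p.1.1.2, Matrix.of p.1.2, p.2))
    (by fun_prop)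

theorem measurable_walsEst_response {S : Type*} [MeasurableSpace S] {N : ℕ}
    {X : S → Matrix (Fin N) (Fin k₁ ⊕ Fin k₂) ℝ} (hX : Measurable X) {ε : S → Fin N → ℝ}
    (hε : Measurable ε) (β₁ : Fin k₁ → ℝ) (δ : Fin k₂ → ℝ) {w : S → Fin k₂ → ℝ}
    (hw : Measurable w) :
    Measurable fun s => walsEst (X s) (response (X s) (ε s) β₁ δ) (w s) := by
  have h1 : Measurable fun s => (X s).toCols₁ :=
    (continuous_id.matrix_submatrix id Sum.inl).measurable.comp hX
  have h2 : Measurable fun s => (X s).toCols₂ :=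
    (continuous_id.matrix_submatrix id Sum.inr).measurable.comp hX
  unfold walsEst narrowEst auxEst starX₂ hatXi hatC annihilator response
  fun_prop

end Limits

end FocusedWALS

open FocusedWALS in
theorem theorem3 {k₁ k₂ : ℕ}
    -- the sample space, and the space that carries the limits
    {S : Type*} [MeasurableSpace S] (P : Measure S) [IsProbabilityMeasure P]
    {S' : Type*} [MeasurableSpace S'] (P' : Measure S') [IsProbabilityMeasure P']
    -- regressors and errors for each sample size, coefficients, focus function
    (X : (N : ℕ) → S → Matrix (Fin N) (Fin k₁ ⊕ Fin k₂) ℝ) (ε : (N : ℕ) → S → Fin N → ℝ)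
    (hX : ∀ N i j, Measurable fun s => X N s i j) (hε : ∀ N, Measurable (ε N))
    (β₁ : Fin k₁ → ℝ) (δ : Fin k₂ → ℝ)
    (μ : (Fin k₁ → ℝ) → ℝ) (hμ : ContDiff ℝ 1 μ)
    -- the second moments converge in probability to a nonsingular matrix
    (Q : Matrix (Fin k₁ ⊕ Fin k₂) (Fin k₁ ⊕ Fin k₂) ℝ) (hQ : Q.PosDef)
    (hlln : ∀ i j, TendstoInMeasure P (fun (N : ℕ) s => ((N : ℝ)⁻¹ • ((X N s)ᵀ * X N s)) i j) atTop
      (fun _ => Q i j))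
    -- the scores converge in distribution to a centred Gaussian vector `R`
    (Om : Matrix (Fin k₁ ⊕ Fin k₂) (Fin k₁ ⊕ Fin k₂) ℝ) (hOm : Om.PosSemidef)
    (R : S' → Fin k₁ ⊕ Fin k₂ → ℝ)
    (hR : HasLaw (fun s => WithLp.toLp 2 (R s)) (multivariateGaussian 0 Om) P')
    (hclt : TendstoInDistribution (fun (N : ℕ) s => (√(N : ℝ))⁻¹ • ((X N s)ᵀ *ᵥ ε N s)) atTop R
      (fun _ => P) P')
    -- a consistent estimator of the covariance matrix
    (hatOm : ℕ → S → Matrix (Fin k₁ ⊕ Fin k₂) (Fin k₁ ⊕ Fin k₂) ℝ)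
    (hhatOm : ∀ N i j, Measurable fun s => hatOm N s i j)
    (hcons : ∀ i j, TendstoInMeasure P (fun N s => hatOm N s i j) atTop (fun _ => Om i j))
    (form : FocusedWALS.AMSEForm)
    -- `hatw` minimizes the plug-in criterion whenever the regressors are linearly independent
    (hatw : ℕ → S → Fin k₂ → ℝ) (hhatw : ∀ N, Measurable (hatw N))
    (hmin : ∀ N, ∀ᵐ s ∂P, ((X N s)ᵀ * X N s).det ≠ 0 →
      hatw N s ∈ FocusedWALS.cubeArgmin
        (form.plugIn μ (X N s) (FocusedWALS.response (X N s) (ε N s) β₁ δ) (hatOm N s)))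
    -- `wstar` is the minimizer of the limiting criterion
    (wstar : S' → Fin k₂ → ℝ)
    (hwstar : ∀ᵐ s ∂P', FocusedWALS.cubeArgmin (form.limit μ β₁ δ Q Om (R s)) = {wstar s}) :
    TendstoInDistribution hatw atTop wstar (fun _ => P) P' ∧
    TendstoInDistribution
      (fun (N : ℕ) s => √(N : ℝ) •
        (FocusedWALS.walsEst (X N s) (FocusedWALS.response (X N s) (ε N s) β₁ δ) (hatw N s) - β₁))
      atTop
      (fun s => FocusedWALS.limitBeta Q δ (Matrix.diagonal (wstar s)) (R s))
      (fun _ => P) P' ∧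
    TendstoInDistribution
      (fun (N : ℕ) s => √(N : ℝ) *
        (μ (FocusedWALS.walsEst (X N s) (FocusedWALS.response (X N s) (ε N s) β₁ δ) (hatw N s))
          - μ β₁))
      atTop
      (fun s => FocusedWALS.limitFocus μ β₁ Q δ (Matrix.diagonal (wstar s)) (R s))
      (fun _ => P) P' := by
  have hXm N : Measurable (X N) := measurable_matrix (hX N)
  have hmom : TendstoInDistribution (fun (N : ℕ) s => ((score (X N s) (ε N s), sampleGram (X N s),
      hatOm N s, (√(N : ℝ))⁻¹) : MomentSpace k₁ k₂)) atTop (fun s => (R s, Q, Om, 0))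
      (fun _ => P) P' :=
    tendstoInDistribution_moments hclt
      (fun N => by have := hXm N; unfold sampleGram; fun_prop)
      (fun N => measurable_matrix (hhatOm N)) hlln hcons
  have hest N := measurable_walsEst_response (hXm N) (hε N) β₁ δ (hhatw N)
  have hjoint : TendstoInDistribution
      (fun (N : ℕ) s => (hatw N s,
        √(N : ℝ) • (walsEst (X N s) (response (X N s) (ε N s) β₁ δ) (hatw N s) - β₁),
        √(N : ℝ) * (μ (walsEst (X N s) (response (X N s) (ε N s) β₁ δ) (hatw N s)) - μ β₁)))
      atTop
      (fun s => (wstar s, limitBeta Q δ (Matrix.diagonal (wstar s)) (R s),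
        limitFocus μ β₁ Q δ (Matrix.diagonal (wstar s)) (R s))) (fun _ => P) P' := by
    refine tendstoInDistribution_of_tendsto_fibre hmom (Γ := solutionSet form μ β₁ δ)
      (U := {e | e.2.1.det ≠ 0}) (fun N => ?_) ?_ ?_ ?_ ?_ ?_
    · have hμm : Measurable fun s =>
          μ (walsEst (X N s) (response (X N s) (ε N s) β₁ δ) (hatw N s)) :=
        hμ.continuous.measurable.comp (hest N)
      have hd : Measurable fun s => √(N : ℝ) •
          (walsEst (X N s) (response (X N s) (ε N s) β₁ δ) (hatw N s) - β₁) :=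
        ((hest N).sub_const β₁).const_smul (√(N : ℝ))
      exact ((hhatw N).prodMk (hd.prodMk ((hμm.sub_const _).const_mul _))).aemeasurable
    · exact isOpen_ne_fun (by fun_prop) continuous_const
    · exact ae_of_all _ fun s => hQ.det_pos.ne'
    · filter_upwards [eventually_ne_atTop 0] with N hN
      have hs : √(N : ℝ) ≠ 0 := (Real.sqrt_pos.2 (by positivity)).ne'
      filter_upwards [hmin N] with s hsmin hdet
      have hpos : (sampleGram (X N s)).PosDef := posDef_sampleGram hdet
      have hbeta : √(N : ℝ) •
          (walsEst (X N s) (response (X N s) (ε N s) β₁ δ) (hatw N s) - β₁)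
          = limitBeta (sampleGram (X N s)) δ (Matrix.diagonal (hatw N s))
              (score (X N s) (ε N s)) := by
        rw [walsEst_response hN hpos, add_sub_cancel_left, smul_smul, mul_inv_cancel₀ hs, one_smul]
      refine ⟨hpos, ?_, hbeta, ?_⟩
      · rw [← plugIn_response form μ hN hpos]
        refine hsmin fun h0 => hdet ?_
        simp [sampleGram, h0]
      · simp only [hbeta]
        rw [focusQuotient_of_ne_zero _ _ _ (inv_ne_zero hs), inv_inv, walsEst_response hN hpos]
    · filter_upwards [hwstar] with s hs
      refine ⟨hQ, ?_, rfl, (focusQuotient_zero _ _ _).symm⟩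
      rw [← limit_eq_criterion, hs]
      rfl
    · filter_upwards [hwstar] with s hs
      exact tendsto_solutionSet_fibre form hμ β₁ δ hQ (R s) hs
  exact ⟨hjoint.continuous_comp continuous_fst,
    hjoint.continuous_comp (continuous_fst.comp continuous_snd),
    hjoint.continuous_comp (continuous_snd.comp continuous_snd)⟩
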